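/- **Corollary (SGD-dependent generalization gap under depolarizing noise).** *Model.* Let $D,L,m\ge 1$ and $N,K,\mathcal T\ge 0$ be integers. An $L$-layer data re-uploading QNN on $N$ qubits is the circuit $U(\theta^{(L+1)})\prod_{l=1}^{L}\bigl(U(x)U(\theta^{(l)})\bigr)$ applied to a density matrix $\rho_{in}$ and followed by the measurement of a Hermitian observable $\mathcal M\in\mathbb C^{2^N\times 2^N}$. Every block is a sequence of fixed unitary gates and single-qubit Pauli rotations $e^{-i\varphi P/2}$, $P\in\{X,Y,Z\}$. Each of the $K$ parameters $\theta\in\mathbb R^K$ is the angle of exactly one rotation in the trainable blocks $U(\theta^{(1)}),\dots,U(\theta^{(L+1)})$; each of the $D$ features of $x\in\mathbb R^D$ is the angle of exactly one rotation of the encoding block $U(x)$, which is applied $L$ times. Under noise of level $p\in[0,1]$, after each gate the depolarizing channel $\mathcal N_p(\rho)=(1-p)\rho+p\,\mathrm{tr}(\rho)\,I/2^N$ acts. Let $f(\theta,x)$ be the resulting expectation value of $\mathcal M$, and let $\|\mathcal M\|_\infty$ be the spectral norm. *Loss.* For every label $y$ in a set $\mathcal Y\subseteq\mathbb R$ and all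 $a,b\in[-\|\mathcal M\|_\infty,\|\mathcal M\|_\infty]$, the measurable loss $\ell$ satisfies $0\le\ell(a,y)\le M$, is differentiable in $a$, and $|\ell(a,y)-\ell(b,y)|\le \mathcal C_1|a-b|$, $|\partial_a\ell(a,y)-\partial_a\ell(b,y)|\le \mathcal C_2|a-b|$. *Algorithm.* Let $S=((x_i,y_i))_{i=1}^m$ be drawn i.i.d. from a probability distribution $\mathbb D$ on $\mathbb R^D\times\mathbb R$ whose labels lie in $\mathcal Y$ almost surely. From an initial $\theta_0\in\mathbb R^K$, drawn from any distribution independently of everything else, $\mathcal A_S$ performs $\mathcal T$ SGD steps $\theta_{t+1}=\theta_t-\eta\nabla_\theta\,\ell(f(\theta_t,x_{i_t}),y_{i_t})$ with learning rate $\eta>0$, the indices $i_t$ being independent and uniform on $\{1,\dots,m\}$. Write $R(\mathcal A_S)=\mathbb E_{(x,y)\sim\mathbb D}[\ell(f(\theta_{\mathcal T},x),y)]$ and $\hat R(\mathcal A_S)=\frac1m\sum_{i=1}^m\ell(f(\theta_{\mathcal T},x_i),y_i)$, and let $\mathbb E_{\rm SGD}$ be the expectation over $\theta_0$ and the indices.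 *Claim.* For all $\mathcal C_1,\mathcal C_2\ge0$ there are functions $g_{\mathcal T}$, $\mathcal T=0,1,2,\dots$, depending only on $\mathcal C_1,\mathcal C_2,\mathcal T$, nondecreasing on $[0,\infty)$, with $g_{\mathcal T}(b)=\mathcal O(b^{\mathcal T})$ as $b\to\infty$, and more precisely $|g_{\mathcal T}(b)|\le (c\,b)^{\mathcal T}$ for all $b\ge1$ and all $\mathcal T$ with a constant $c=c(\mathcal C_1,\mathcal C_2)>0$, such that in every situation as above and for every $\delta\in(0,1)$, with probability at least $1-\delta$ over the draw of $S$, $$\mathbb E_{\rm SGD}[R(\mathcal A_S)-\hat R(\mathcal A_S)]\le \frac{(1-p)^{LD}LD\|\mathcal M\|_\infty}{m}\,g_{\mathcal T}\!\left(\eta(1-p)^{K}K\|\mathcal M\|_\infty\right)+\left((1-p)^{LD}LD\|\mathcal M\|_\infty\; g_{\mathcal T}\!\left(\eta(1-p)^{K}K\|\mathcal M\|_\infty\right)+M\right)\sqrt{\frac{\log\frac1\delta}{2m}} .$$ -/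

import Mathlib

open MeasureTheory
open scoped ComplexOrder

noncomputable section

namespace NoisyQNN

/-- Computational basis of a register of `N` qubits (so its Hilbert space has dimension `2 ^ N`). -/
abbrev Basis (N : ℕ) : Type := Fin N → Fin 2

/-- Operators on a register of `N` qubits. -/
abbrev Op (N : ℕ) : Type := Matrix (Basis N) (Basis N) ℂ

/-- The three Pauli labels. -/
inductive Pauli : Type
  | X
  | Y
  | Z

/-- The Pauli matrices. -/
def Pauli.toMatrix : Pauli → Matrix (Fin 2) (Fin 2) ℂ
  | .X => !![0, 1; 1, 0]
  | .Y => !![0, -Complex.I; Complex.I, 0]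
  | .Z => !![1, 0; 0, -1]

/-- The single-qubit operator `A` acting on qubit `q`, tensored with the identity on all other
qubits. -/
def onQubit {N : ℕ} (q : Fin N) (A : Matrix (Fin 2) (Fin 2) ℂ) : Op N :=
  Matrix.of fun s t => if ∀ r, r ≠ q → s r = t r then A (s q) (t q) else 0

/-- The Pauli rotation `exp (-i φ P / 2)` on qubit `q`. -/
def pauliRotation {N : ℕ} (P : Pauli) (q : Fin N) (φ : ℝ) : Op N :=
  NormedSpace.exp ((-(Complex.I * (φ : ℂ) / 2)) • onQubit q P.toMatrix)

/-- A gate on `N` qubits: either a fixed unitary, or a single-qubit Pauli rotation whose angle is the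
coordinate `i` of an angle vector indexed by `ι`. -/
inductive Gate (N : ℕ) (ι : Type) : Type
  | fixed (V : Matrix.unitaryGroup (Basis N) ℂ) : Gate N ι
  | rotation (i : ι) (P : Pauli) (q : Fin N) : Gate N ι

/-- The unitary implemented by a gate at the angle vector `v`. -/
def Gate.toOp {N : ℕ} {ι : Type} (v : ι → ℝ) : Gate N ι → Op N
  | .fixed V => (V : Op N)
  | .rotation i P q => pauliRotation P q (v i)

/-- The coordinate of the angle vector that a gate uses, if any. -/
def Gate.coord? {N : ℕ} {ι : Type} : Gate N ι → Option ι
  | .fixed _ => none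
  | .rotation i _ _ => some i

/-- The depolarizing channel `ρ ↦ (1 - p) ρ + p tr(ρ) I / 2 ^ N`: with probability `1 - p` the state
is unchanged, with probability `p` it is replaced by the maximally mixed state. -/
def depolarize {N : ℕ} (p : ℝ) (ρ : Op N) : Op N :=
  ((1 - p : ℝ) : ℂ) • ρ + ((p : ℂ) * ρ.trace / 2 ^ N) • (1 : Op N)

/-- The spectral norm (Schatten norm of order infinity) of an operator. -/
def opNorm {N : ℕ} (A : Op N) : ℝ := ‖Matrix.toEuclideanCLM (𝕜 := ℂ) A‖

/-- A data re-uploading quantum neural network on `N` qubits with `K` trainable parameters, data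
dimension `D` and `L` layers. Gates in a list act from left to right. -/
structure DataReuploadingQNN (N K D L : ℕ) where
  /-- the trainable blocks `U(θ⁽¹⁾), …, U(θ⁽ᴸ⁺¹⁾)` -/
  trainable : Fin (L + 1) → List (Gate N (Fin K))
  /-- the data-encoding block `U(x)`, which is applied `L` times -/
  encoding : List (Gate N (Fin D))
  /-- the input state -/
  ρin : Op N
  /-- the measured observable -/
  obs : Op N
  /-- each of the `K` trainable parameters is the angle of exactly one rotation gate -/
  trainable_perm :
    ((List.ofFn trainable).flatten.filterMap Gate.coord?).Perm (List.finRange K)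
  /-- each of the `D` features is the angle of exactly one rotation gate of the encoding block -/
  encoding_perm : (encoding.filterMap Gate.coord?).Perm (List.finRange D)
  ρin_posSemidef : ρin.PosSemidef
  ρin_trace : ρin.trace = 1
  obs_hermitian : obs.IsHermitian

namespace DataReuploadingQNN

variable {N K D L : ℕ}

/-- The unitaries of all gates of the circuit
`U(θ⁽ᴸ⁺¹⁾) U(x) U(θ⁽ᴸ⁾) ⋯ U(θ⁽²⁾) U(x) U(θ⁽¹⁾)`, in the order in which they are applied. -/
def gates (Q : DataReuploadingQNN N K D L) (θ : Fin K → ℝ) (x : Fin D → ℝ) : List (Op N) :=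
  (Q.trainable 0).map (Gate.toOp θ) ++
    (List.ofFn fun l : Fin L =>
      Q.encoding.map (Gate.toOp x) ++ (Q.trainable l.succ).map (Gate.toOp θ)).flatten

/-- The state at the end of the circuit, when each gate is followed by depolarizing noise of
level `p`. -/
def outputState (Q : DataReuploadingQNN N K D L) (p : ℝ) (θ : Fin K → ℝ) (x : Fin D → ℝ) : Op N :=
  (Q.gates θ x).foldl (fun ρ U => depolarize p (U * ρ * U.conjTranspose)) Q.ρin

/-- The output function `f(θ, x)` of the noisy network: the expectation value of the observable. -/
def output (Q : DataReuploadingQNN N K D L) (p : ℝ) (θ : Fin K → ℝ) (x : Fin D → ℝ) : ℝ :=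
  ((Q.outputState p θ x * Q.obs).trace).re

/-- One step of stochastic gradient descent with learning rate `η`, on the sample `z = (x, y)`:
`θ⁽ʲ⁾ ↦ θ⁽ʲ⁾ - η ∂ℓ(f(θ, x), y)/∂θ⁽ʲ⁾` for every `j`. -/
def sgdStep (Q : DataReuploadingQNN N K D L) (p : ℝ) (ℓ : ℝ → ℝ → ℝ) (η : ℝ)
    (z : (Fin D → ℝ) × ℝ) (θ : Fin K → ℝ) : Fin K → ℝ :=
  fun j => θ j - η * deriv (fun u => ℓ (Q.output p (Function.update θ j u) z.1) z.2) (θ j)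

/-- The parameters after `T` steps from `θ₀` on the training set `S`, where step `t` uses the sample
with index `ω t`. -/
def sgd (Q : DataReuploadingQNN N K D L) (p : ℝ) (ℓ : ℝ → ℝ → ℝ) (η : ℝ) {m T : ℕ}
    (S : Fin m → (Fin D → ℝ) × ℝ) (ω : Fin T → Fin m) (θ₀ : Fin K → ℝ) : Fin K → ℝ :=
  (List.ofFn ω).foldl (fun θ i => Q.sgdStep p ℓ η (S i) θ) θ₀

/-- The expected risk at `θ` for the data distribution `𝔻`. -/
def risk (Q : DataReuploadingQNN N K D L) (p : ℝ) (ℓ : ℝ → ℝ → ℝ)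
    (𝔻 : Measure ((Fin D → ℝ) × ℝ)) (θ : Fin K → ℝ) : ℝ :=
  ∫ z, ℓ (Q.output p θ z.1) z.2 ∂𝔻

/-- The empirical risk at `θ` on the training set `S`. -/
def empiricalRisk (Q : DataReuploadingQNN N K D L) (p : ℝ) (ℓ : ℝ → ℝ → ℝ) {m : ℕ}
    (S : Fin m → (Fin D → ℝ) × ℝ) (θ : Fin K → ℝ) : ℝ :=
  (∑ i, ℓ (Q.output p θ (S i).1) (S i).2) / m

/-- The expectation over the randomness of `T`-step stochastic gradient descent on `S` of a function
`F` of the learned parameters: the initial parameters are drawn from `ν`, and the sample index of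
each step is uniform on `Fin m`, independently of everything else. -/
def sgdExpectation (Q : DataReuploadingQNN N K D L) (p : ℝ) (ℓ : ℝ → ℝ → ℝ) (η : ℝ) {m : ℕ} (T : ℕ)
    (ν : Measure (Fin K → ℝ)) (S : Fin m → (Fin D → ℝ) × ℝ) (F : (Fin K → ℝ) → ℝ) : ℝ :=
  ∫ θ₀, (∑ ω : Fin T → Fin m, F (Q.sgd p ℓ η S ω θ₀)) / (m : ℝ) ^ T ∂ν

/-- The expected generalization gap `𝔼_SGD[R(A_S) - R̂_S(A_S)]`. -/
def expectedGap (Q : DataReuploadingQNN N K D L) (p : ℝ) (ℓ : ℝ → ℝ → ℝ) (η : ℝ) {m : ℕ} (T : ℕ)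
    (ν : Measure (Fin K → ℝ)) (𝔻 : Measure ((Fin D → ℝ) × ℝ))
    (S : Fin m → (Fin D → ℝ) × ℝ) : ℝ :=
  Q.sgdExpectation p ℓ η T ν S fun θ => Q.risk p ℓ 𝔻 θ - Q.empiricalRisk p ℓ S θ

end DataReuploadingQNN

/-- The loss `ℓ(a, y)` is, for labels `y ∈ 𝒴` and predictions `|a| ≤ B`, Lipschitz continuous with
constant `C₁` and smooth with constant `C₂` in the prediction. -/
structure IsLipschitzSmooth (ℓ : ℝ → ℝ → ℝ) (𝒴 : Set ℝ) (B C₁ C₂ : ℝ) : Prop where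
  lipschitz : ∀ y ∈ 𝒴, ∀ a ∈ Set.Icc (-B) B, ∀ b ∈ Set.Icc (-B) B,
    |ℓ a y - ℓ b y| ≤ C₁ * |a - b|
  differentiable : ∀ y ∈ 𝒴, ∀ a ∈ Set.Icc (-B) B, DifferentiableAt ℝ (fun u => ℓ u y) a
  smooth : ∀ y ∈ 𝒴, ∀ a ∈ Set.Icc (-B) B, ∀ b ∈ Set.Icc (-B) B,
    |deriv (fun u => ℓ u y) a - deriv (fun u => ℓ u y) b| ≤ C₂ * |a - b|

/-- `g T b` is `O(b ^ T)` for growing `b`, with a constant of the form `c ^ T`, and is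
nondecreasing in `b ≥ 0` (so that it is at most `c ^ T` for `b ≤ 1`). -/
def IsBigOPow (g : ℕ → ℝ → ℝ) : Prop :=
  (∀ T, MonotoneOn (g T) (Set.Ici 0)) ∧
    ∃ c : ℝ, 0 < c ∧ ∀ (T : ℕ) (b : ℝ), 1 ≤ b → |g T b| ≤ (c * b) ^ T

end NoisyQNN

end

/-! The argument is uniform stability combined with McDiarmid's inequality.

Noise. Depolarizing noise commutes with unitary conjugation, so a circuit of `n` gates outputs `d`
times its noiseless expectation plus a constant, with `d = (1 - p) ^ n` (`foldl_depolarize`,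
`output_eq`). The rotations alone give `n ≥ L * D + K`, hence `d ≤ (1 - p) ^ (L * D) * (1 - p) ^ K`.
As a function of one trainable angle the noiseless expectation is `a + b cos u + c sin u` and is
bounded by `‖obs‖`; the parameter-shift rule bounds its slope by the same number. The loss is
therefore `κ`-Lipschitz in each parameter, with `κ = C₁ d ‖obs‖`.

Stability. Two runs with the same initial point and indices, on training sets that differ only in
sample `i`, coincide unless `i` is drawn, which has probability at most `T / m`. If it is drawn,
each coordinate of either run is within `T η κ` of the initial point. The expected loss thus changes
by at most `β = (T / m) * κ * K * 2 T η κ`. This needs no recursion for the divergence of the two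
runs, and it leads to a growth function linear in `b`, namely `4 C₁² T² b`. That is within `(c b) ^
T` when `T ≥ 1`, and it vanishes at `T = 0`. Since `d² ≤ d` and `1 ≤ L * D`, the quantity `2 m β` is
at most the prefactor of the claim times this function (`stability_le_growth`).

Generalization. For a `β`-stable rule the gap has mean at most `β`, and its differences under
replacement of one sample are at most `2 β + M / m`. McDiarmid's inequality turns this into the
bound with probability `1 - δ`. -/

noncomputable section

open ProbabilityTheory

/-! ### McDiarmid's inequality and generalization of uniformly stable rules. -/

section Concentration

variable {Z : Type*} [MeasurableSpace Z]

theorem integrable_of_measurable_of_abs_le {Ω : Type*} [MeasurableSpace Ω] {μ : Measure Ω}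
    [IsFiniteMeasure μ] {f : Ω → ℝ} (hf : Measurable f) {R : ℝ} (hR : ∀ x, |f x| ≤ R) :
    Integrable f μ :=
  Integrable.of_bound hf.aestronglyMeasurable R (Filter.Eventually.of_forall fun x => hR x)

theorem abs_integral_le_of_abs_le {Ω : Type*} [MeasurableSpace Ω] {μ : Measure Ω}
    [IsProbabilityMeasure μ] {f : Ω → ℝ} {R : ℝ} (hR : ∀ x, |f x| ≤ R) :
    |∫ x, f x ∂μ| ≤ R := by
  simpa using norm_integral_le_of_norm_le_const (μ := μ) (f := f) (C := R)
    (Filter.Eventually.of_forall fun x => hR x)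

/-- Fubini with one sample singled out: index `0` drives the induction for the exponential moment,
and a general `i` is needed to exchange a training sample with a fresh one. -/
theorem integral_pi_fin_succ (𝔻 : Measure Z) [IsProbabilityMeasure 𝔻] {n : ℕ}
    (i : Fin (n + 1)) {F : (Fin (n + 1) → Z) → ℝ} (hF : Measurable F) {R : ℝ}
    (hR : ∀ S, |F S| ≤ R) :
    ∫ S, F S ∂(Measure.pi fun _ => 𝔻)
      = ∫ z, ∫ S, F (i.insertNth z S) ∂(Measure.pi fun _ : Fin n => 𝔻) ∂𝔻 := by
  have h := (measurePreserving_piFinSuccAbove (fun _ : Fin (n + 1) => 𝔻) i).symm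
  rw [← h.integral_comp' (g := F), integral_prod]
  · rfl
  · exact integrable_of_measurable_of_abs_le (hF.comp (MeasurableEquiv.measurable _))
      (fun x => hR _)

theorem measurable_insertNth {n : ℕ} (i : Fin (n + 1)) :
    Measurable fun q : Z × (Fin n → Z) => (i.insertNth q.1 q.2 : Fin (n + 1) → Z) :=
  (MeasurableEquiv.piFinSuccAbove (fun _ : Fin (n + 1) => Z) i).symm.measurable

/-- Exponential moment bound behind McDiarmid's inequality. -/
theorem integral_exp_le_of_bounded_differences (𝔻 : Measure Z) [IsProbabilityMeasure 𝔻]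
    {c R : ℝ} (hc : 0 ≤ c) (t : ℝ) (n : ℕ) (F : (Fin n → Z) → ℝ) (hF : Measurable F)
    (hR : ∀ S, |F S| ≤ R)
    (hd : ∀ S i z, |F (Function.update S i z) - F S| ≤ c) :
    ∫ S, Real.exp (t * (F S - ∫ S', F S' ∂(Measure.pi fun _ => 𝔻))) ∂(Measure.pi fun _ => 𝔻)
      ≤ Real.exp (n * (c / 2) ^ 2 * t ^ 2 / 2) := by
  induction n with
  | zero =>
    have h : ∀ S : Fin 0 → Z, F S = F finZeroElim := fun S => by
      congr 1; exact Subsingleton.elim _ _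
    have hE : ∫ S', F S' ∂(Measure.pi fun _ => 𝔻) = F finZeroElim := by
      simp_rw [h]; simp
    rw [hE]
    simp_rw [h]
    simp
  | succ n ih =>
    set E := ∫ S', F S' ∂(Measure.pi fun _ => 𝔻) with hE
    set ψ : Z → ℝ := fun z => ∫ S, F ((0 : Fin (n + 1)).insertNth z S)
      ∂(Measure.pi fun _ : Fin n => 𝔻) with hψ
    have hFi : Measurable fun q : Z × (Fin n → Z) => F ((0 : Fin (n + 1)).insertNth q.1 q.2) :=
      hF.comp (measurable_insertNth 0)
    have hFz : ∀ z, Measurable fun S : Fin n → Z => F ((0 : Fin (n + 1)).insertNth z S) :=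
      fun z => hFi.comp measurable_prodMk_left
    have hψm : Measurable ψ := (hFi.stronglyMeasurable.integral_prod_right').measurable
    have hψR : ∀ z, |ψ z| ≤ R := fun z => abs_integral_le_of_abs_le fun S => hR _
    have hEψ : E = ∫ z, ψ z ∂𝔻 := integral_pi_fin_succ 𝔻 0 hF hR
    -- Averaging over the other coordinates preserves the bounded difference in the first one, so
    -- `ψ` takes values in an interval of length `c`.
    have hosc : ∀ z z', ψ z ≤ ψ z' + c := by
      intro z z'
      have : ψ z' + c = ∫ S, (F ((0 : Fin (n + 1)).insertNth z' S) + c)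
          ∂(Measure.pi fun _ : Fin n => 𝔻) := by
        rw [integral_add (integrable_of_measurable_of_abs_le (hFz z') fun S => hR _)
          (integrable_const _)]
        simp [hψ]
      rw [this]
      refine integral_mono (integrable_of_measurable_of_abs_le (hFz z) fun S => hR _)
        ((integrable_of_measurable_of_abs_le (hFz z') fun S => hR _).add (integrable_const _)) ?_
      intro S
      have := hd ((0 : Fin (n + 1)).insertNth z' S) 0 z
      simp only [Fin.insertNth_zero', Fin.update_cons_zero] at this ⊢
      have := (abs_le.1 this).2
      linarith
    have : Nonempty Z := nonempty_of_isProbabilityMeasure 𝔻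
    have hbdd : BddBelow (Set.range ψ) :=
      ⟨-R, by rintro _ ⟨z, rfl⟩; exact (abs_le.1 (hψR z)).1⟩
    have hmem : ∀ z, ψ z ∈ Set.Icc (⨅ z, ψ z) ((⨅ z, ψ z) + c) := by
      intro z
      refine ⟨ciInf_le hbdd z, ?_⟩
      have : ψ z - c ≤ ⨅ z, ψ z := le_ciInf fun z' => by linarith [hosc z z']
      linarith
    -- Hoeffding's lemma for `ψ`: each coordinate contributes a variance proxy `(c / 2) ^ 2`.
    have hsub := (hasSubgaussianMGF_of_mem_Icc (μ := 𝔻) hψm.aemeasurable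
      (Filter.Eventually.of_forall hmem)).mgf_le t
    have hexpR : ∀ u e : ℝ, |u| ≤ R → |Real.exp (t * (u - e))| ≤ Real.exp (|t| * (R + |e|)) := by
      intro u e hu
      rw [abs_of_pos (Real.exp_pos _)]
      refine Real.exp_le_exp.2 ((le_abs_self _).trans ?_)
      rw [abs_mul]
      gcongr
      exact (abs_sub _ _).trans (by gcongr)
    rw [integral_pi_fin_succ 𝔻 0 (by fun_prop) fun S => hexpR _ E (hR S)]
    -- With the first coordinate frozen, `F - E = (F - ψ z) + (ψ z - E)`; the induction hypothesis
    -- bounds the first part and the second is constant in `S`.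
    have hinner : ∀ z, ∫ S, Real.exp (t * (F ((0 : Fin (n + 1)).insertNth z S) - E))
          ∂(Measure.pi fun _ : Fin n => 𝔻)
        ≤ Real.exp (n * (c / 2) ^ 2 * t ^ 2 / 2) * Real.exp (t * (ψ z - E)) := by
      intro z
      have := ih (fun S => F ((0 : Fin (n + 1)).insertNth z S)) (hFz z) (fun S => hR _) ?_
      · have h2 : ∀ S : Fin n → Z, Real.exp (t * (F ((0 : Fin (n + 1)).insertNth z S) - E))
            = Real.exp (t * (F ((0 : Fin (n + 1)).insertNth z S) - ψ z))
              * Real.exp (t * (ψ z - E)) := by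
          intro S
          rw [← Real.exp_add]
          ring_nf
        simp_rw [h2]
        rw [integral_mul_const]
        gcongr
      · intro S i w
        have := hd ((0 : Fin (n + 1)).insertNth z S) i.succ w
        simpa only [Fin.insertNth_zero', Fin.cons_update] using this
    calc _ ≤ ∫ z, Real.exp (n * (c / 2) ^ 2 * t ^ 2 / 2) * Real.exp (t * (ψ z - E)) ∂𝔻 := by
          refine integral_mono ?_ ?_ hinner
          · refine integrable_of_measurable_of_abs_le (R := Real.exp (|t| * (R + |E|))) ?_ ?_
            · exact (StronglyMeasurable.integral_prod_right'
                (f := fun q : Z × (Fin n → Z) =>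
                  Real.exp (t * (F ((0 : Fin (n + 1)).insertNth q.1 q.2) - E)))
                (Real.measurable_exp.comp ((hFi.sub_const E).const_mul t)).stronglyMeasurable).measurable
            · exact fun z => abs_integral_le_of_abs_le fun S => hexpR _ E (hR _)
          · exact (integrable_of_measurable_of_abs_le (by fun_prop)
              (fun z => hexpR _ E (hψR z))).const_mul _
      _ = Real.exp (n * (c / 2) ^ 2 * t ^ 2 / 2) * mgf (fun z => ψ z - ∫ z, ψ z ∂𝔻) 𝔻 t := by
          rw [integral_const_mul, mgf, hEψ]
      _ ≤ _ := by
          refine (mul_le_mul_of_nonneg_left hsub (Real.exp_pos _).le).trans (le_of_eq ?_)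
          rw [← Real.exp_add]
          congr 1
          simp only [add_sub_cancel_left, NNReal.coe_pow, NNReal.coe_div, coe_nnnorm,
            Real.norm_eq_abs, abs_of_nonneg hc, NNReal.coe_ofNat]
          push_cast
          ring

/-- **McDiarmid's inequality** for i.i.d. coordinates. -/
theorem measure_ge_le_of_bounded_differences (𝔻 : Measure Z) [IsProbabilityMeasure 𝔻]
    {c R : ℝ} (hc : 0 < c) {n : ℕ} (hn : 0 < n) {F : (Fin n → Z) → ℝ} (hF : Measurable F)
    (hR : ∀ S, |F S| ≤ R)
    (hd : ∀ S i z, |F (Function.update S i z) - F S| ≤ c) {ε : ℝ} (hε : 0 ≤ ε) :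
    (Measure.pi fun _ => 𝔻).real {S | ε ≤ F S - ∫ S', F S' ∂(Measure.pi fun _ => 𝔻)}
      ≤ Real.exp (-2 * ε ^ 2 / (n * c ^ 2)) := by
  set E := ∫ S', F S' ∂(Measure.pi fun _ => 𝔻) with hE
  have hn' : (0 : ℝ) < n := by exact_mod_cast hn
  have hsub : HasSubgaussianMGF (fun S => F S - E) ⟨n * (c / 2) ^ 2, by positivity⟩
      (Measure.pi fun _ => 𝔻) := by
    constructor
    · intro t
      refine integrable_of_measurable_of_abs_le (R := Real.exp (|t| * (R + |E|)))
        (by fun_prop) fun S => ?_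
      rw [abs_of_pos (Real.exp_pos _)]
      refine Real.exp_le_exp.2 ((le_abs_self _).trans ?_)
      rw [abs_mul]
      gcongr
      exact (abs_sub _ _).trans (by gcongr; exact hR S)
    · intro t
      exact integral_exp_le_of_bounded_differences 𝔻 hc.le t n F hF hR hd
  refine (hsub.measure_ge_le hε).trans (le_of_eq ?_)
  congr 1
  change -ε ^ 2 / (2 * (n * (c / 2) ^ 2)) = _
  field_simp

/-- A uniformly stable learning rule generalizes in expectation. -/
theorem integral_gap_le_of_uniformly_stable (𝔻 : Measure Z) [IsProbabilityMeasure 𝔻]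
    {β M : ℝ} {m : ℕ} (hm : 0 < m) {H : (Fin m → Z) → Z → ℝ}
    (hH : Measurable (Function.uncurry H)) (hM : ∀ S z, |H S z| ≤ M)
    (hβ : ∀ S i w z, |H (Function.update S i w) z - H S z| ≤ β) :
    ∫ S, (∫ z, H S z ∂𝔻 - (∑ i, H S (S i)) / m) ∂(Measure.pi fun _ => 𝔻) ≤ β := by
  obtain ⟨n, rfl⟩ := Nat.exists_eq_succ_of_ne_zero hm.ne'
  have hm' : (0 : ℝ) < (n.succ : ℕ) := by exact_mod_cast hm
  have hmean : Measurable fun S => ∫ z, H S z ∂𝔻 :=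
    (StronglyMeasurable.integral_prod_right' (f := Function.uncurry H)
      hH.stronglyMeasurable).measurable
  have hmeanM : ∀ S, |∫ z, H S z ∂𝔻| ≤ M := fun S => abs_integral_le_of_abs_le fun z => hM _ _
  have hmeas : ∀ i, Measurable fun S => H S (S i) := fun i =>
    hH.comp (measurable_id.prodMk (measurable_pi_apply i))
  have hi : ∀ i, ∫ S, ∫ z, H S z ∂𝔻 ∂(Measure.pi fun _ => 𝔻)
      ≤ ∫ S, H S (S i) ∂(Measure.pi fun _ => 𝔻) + β := by
    intro i
    rw [integral_pi_fin_succ 𝔻 i hmean hmeanM, integral_pi_fin_succ 𝔻 i (hmeas i)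
      fun S => hM _ _]
    simp only [Fin.insertNth_apply_same]
    have hG : Measurable fun q : Z × (Fin n → Z) => H (i.insertNth q.1 q.2) q.1 :=
      hH.comp ((measurable_insertNth i).prodMk measurable_fst)
    have hGS : ∀ S : Fin n → Z, Measurable fun z => H (i.insertNth z S) z := fun S =>
      hG.comp measurable_prodMk_right
    have hG2 : Measurable fun S : Fin n → Z => ∫ z, H (i.insertNth z S) z ∂𝔻 :=
      (StronglyMeasurable.integral_prod_left' (f := fun q : Z × (Fin n → Z) =>
        H (i.insertNth q.1 q.2) q.1) hG.stronglyMeasurable).measurable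
    -- Stability allows the training sample `w` in slot `i` to be replaced by the test point `z`
    -- itself at cost `β`. The right-hand side no longer depends on `w` and, after Fubini, is the
    -- mean loss at the `i`-th training sample plus `β`.
    have hfix : ∀ w, ∫ S, ∫ z, H (i.insertNth w S) z ∂𝔻 ∂(Measure.pi fun _ : Fin n => 𝔻)
        ≤ ∫ S, ∫ z, H (i.insertNth z S) z ∂𝔻 ∂(Measure.pi fun _ : Fin n => 𝔻) + β := by
      intro w
      have hconst : ∫ S, ∫ z, H (i.insertNth z S) z ∂𝔻 ∂(Measure.pi fun _ : Fin n => 𝔻) + β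
          = ∫ S, (∫ z, H (i.insertNth z S) z ∂𝔻 + β) ∂(Measure.pi fun _ : Fin n => 𝔻) := by
        rw [integral_add (integrable_of_measurable_of_abs_le hG2
          fun S => abs_integral_le_of_abs_le fun z => hM _ _) (integrable_const _)]
        simp
      rw [hconst]
      refine integral_mono ?_ ?_ fun S => ?_
      · exact integrable_of_measurable_of_abs_le
          (hmean.comp ((measurable_insertNth i).comp measurable_prodMk_left)) fun S => hmeanM _
      · exact (integrable_of_measurable_of_abs_le hG2
          fun S => abs_integral_le_of_abs_le fun z => hM _ _).add (integrable_const _)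
      · have hconst' : ∫ z, H (i.insertNth z S) z ∂𝔻 + β
            = ∫ z, (H (i.insertNth z S) z + β) ∂𝔻 := by
          rw [integral_add (integrable_of_measurable_of_abs_le (hGS S) fun z => hM _ _)
            (integrable_const _)]
          simp
        simp only
        rw [hconst']
        refine integral_mono ?_ ?_ fun z => ?_
        · exact integrable_of_measurable_of_abs_le (hH.comp measurable_prodMk_left)
            fun z => hM _ _
        · exact (integrable_of_measurable_of_abs_le (hGS S) fun z => hM _ _).add
            (integrable_const _)
        · have h := hβ (i.insertNth w S) i z z
          have hup : Function.update (i.insertNth w S : Fin (n + 1) → Z) i z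
              = i.insertNth z S := by simp
          rw [hup] at h
          have := (abs_le.1 h).1
          simp only
          linarith
    have hswap : ∫ w, ∫ S, H (i.insertNth w S) w ∂(Measure.pi fun _ : Fin n => 𝔻) ∂𝔻
        = ∫ S, ∫ z, H (i.insertNth z S) z ∂𝔻 ∂(Measure.pi fun _ : Fin n => 𝔻) :=
      integral_integral_swap (integrable_of_measurable_of_abs_le (f := fun q : Z × (Fin n → Z) =>
        H (i.insertNth q.1 q.2) q.1) hG fun q => hM _ _)
    rw [hswap]
    calc _ ≤ ∫ _ : Z, (∫ S, ∫ z, H (i.insertNth z S) z ∂𝔻 ∂(Measure.pi fun _ : Fin n => 𝔻) + β)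
          ∂𝔻 := by
          refine integral_mono ?_ (integrable_const _) hfix
          refine integrable_of_measurable_of_abs_le (R := M) ?_
            fun w => abs_integral_le_of_abs_le fun S => hmeanM _
          exact (StronglyMeasurable.integral_prod_right' (f := fun q : Z × (Fin n → Z) =>
            ∫ z, H (i.insertNth q.1 q.2) z ∂𝔻)
            (hmean.comp (measurable_insertNth i)).stronglyMeasurable).measurable
      _ = _ := by simp
  rw [integral_sub (integrable_of_measurable_of_abs_le hmean hmeanM)
    ((integrable_finsetSum _ fun i _ => integrable_of_measurable_of_abs_le (hmeas i)
      fun S => hM _ _).div_const _), integral_div, integral_finsetSum _ fun i _ =>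
      integrable_of_measurable_of_abs_le (hmeas i) fun S => hM _ _, sub_le_iff_le_add,
    ← sub_le_iff_le_add', le_div_iff₀ hm']
  have hsum := Finset.sum_le_sum fun i (_ : i ∈ Finset.univ) => hi i
  rw [Finset.sum_add_distrib] at hsum
  simp only [Finset.sum_const, Finset.card_univ, Fintype.card_fin, nsmul_eq_mul] at hsum
  nlinarith [hsum]

/-- High-probability generalization bound for uniformly stable learning rules. -/
theorem measure_gap_le_of_uniformly_stable (𝔻 : Measure Z) [IsProbabilityMeasure 𝔻]
    {β M : ℝ} (hβ0 : 0 ≤ β) {m : ℕ} (hm : 0 < m) {H : (Fin m → Z) → Z → ℝ}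
    (hH : Measurable (Function.uncurry H)) (hM : ∀ S z, 0 ≤ H S z ∧ H S z ≤ M)
    (hβ : ∀ S i w z, |H (Function.update S i w) z - H S z| ≤ β)
    {δ : ℝ} (hδ : δ ∈ Set.Ioo (0 : ℝ) 1) :
    ENNReal.ofReal (1 - δ) ≤ Measure.pi (fun _ : Fin m => 𝔻)
      {S | ∫ z, H S z ∂𝔻 - (∑ i, H S (S i)) / m
        ≤ β + (2 * m * β + M) * Real.sqrt (Real.log (1 / δ) / (2 * m))} := by
  have hm' : (0 : ℝ) < m := by exact_mod_cast hm
  have : Nonempty Z := nonempty_of_isProbabilityMeasure 𝔻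
  obtain ⟨z₀⟩ := this
  have hM0 : 0 ≤ M := (hM (fun _ => z₀) z₀).1.trans (hM (fun _ => z₀) z₀).2
  have hMabs : ∀ S z, |H S z| ≤ M := fun S z => abs_le.2 ⟨by linarith [(hM S z).1], (hM S z).2⟩
  set F : (Fin m → Z) → ℝ := fun S => ∫ z, H S z ∂𝔻 - (∑ i, H S (S i)) / m with hFdef
  have hmean : Measurable fun S => ∫ z, H S z ∂𝔻 :=
    (StronglyMeasurable.integral_prod_right' (f := Function.uncurry H)
      hH.stronglyMeasurable).measurable
  have hmeas : ∀ i, Measurable fun S => H S (S i) := fun i =>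
    hH.comp (measurable_id.prodMk (measurable_pi_apply i))
  have hF : Measurable F :=
    hmean.sub ((Finset.measurable_sum _ fun i _ => hmeas i).div_const _)
  have hsec : ∀ S, Integrable (H S) 𝔻 := fun S =>
    integrable_of_measurable_of_abs_le (hH.comp measurable_prodMk_left) (hMabs S)
  have hmean_mem : ∀ S, 0 ≤ ∫ z, H S z ∂𝔻 ∧ ∫ z, H S z ∂𝔻 ≤ M := fun S =>
    ⟨integral_nonneg fun z => (hM S z).1,
      (abs_le.1 (abs_integral_le_of_abs_le fun z => hMabs S z)).2⟩
  have hemp_mem : ∀ S, 0 ≤ (∑ i, H S (S i)) / m ∧ (∑ i, H S (S i)) / m ≤ M := by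
    refine fun S => ⟨div_nonneg (Finset.sum_nonneg fun i _ => (hM S _).1) hm'.le, ?_⟩
    rw [div_le_iff₀ hm']
    refine (Finset.sum_le_sum fun i _ => (hM S (S i)).2).trans (le_of_eq ?_)
    simp [mul_comm]
  have hFR : ∀ S, |F S| ≤ M := fun S => abs_le.2
    ⟨by simp only [hFdef]; linarith [(hmean_mem S).1, (hemp_mem S).2],
      by simp only [hFdef]; linarith [(hmean_mem S).2, (hemp_mem S).1]⟩
  -- One `β` comes from the true mean and one from the empirical terms by stability; the replaced
  -- sample's own term changes by at most `M`, which is `M / m` after averaging.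
  have hd : ∀ S i w, |F (Function.update S i w) - F S| ≤ 2 * β + M / m := by
    intro S i w
    have h1 : |∫ z, H (Function.update S i w) z ∂𝔻 - ∫ z, H S z ∂𝔻| ≤ β := by
      rw [← integral_sub (hsec _) (hsec _)]
      exact abs_integral_le_of_abs_le fun z => hβ S i w z
    have h2 : |∑ k, H (Function.update S i w) (Function.update S i w k) - ∑ k, H S (S k)|
        ≤ m * β + M := by
      rw [← Finset.sum_sub_distrib]
      refine (Finset.abs_sum_le_sum_abs _ _).trans ?_
      have hk : ∀ k, |H (Function.update S i w) (Function.update S i w k) - H S (S k)|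
          ≤ β + if k = i then M else 0 := by
        intro k
        split_ifs with hki
        · have ha := hM (Function.update S i w) (Function.update S i w k)
          have hb := hM S (S k)
          exact abs_le.2 ⟨by linarith, by linarith⟩
        · rw [Function.update_of_ne hki, add_zero]
          exact hβ S i w (S k)
      refine (Finset.sum_le_sum fun k _ => hk k).trans (le_of_eq ?_)
      simp [Finset.sum_add_distrib]
    have h3 : F (Function.update S i w) - F S
        = (∫ z, H (Function.update S i w) z ∂𝔻 - ∫ z, H S z ∂𝔻)
          - (∑ k, H (Function.update S i w) (Function.update S i w k) - ∑ k, H S (S k)) / m := by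
      simp only [hFdef]; ring
    rw [h3]
    refine (abs_sub _ _).trans ?_
    rw [abs_div, abs_of_pos hm']
    have h4 := div_le_div_of_nonneg_right h2 hm'.le
    have h5 : (m * β + M) / m = β + M / m := by field_simp
    linarith
  have hE := integral_gap_le_of_uniformly_stable 𝔻 hm hH hMabs hβ
  set s := Real.sqrt (Real.log (1 / δ) / (2 * m)) with hs
  have hlog : 0 ≤ Real.log (1 / δ) / (2 * m) :=
    div_nonneg (Real.log_nonneg (by rw [le_div_iff₀ hδ.1]; linarith [hδ.2])) (by positivity)
  -- McDiarmid needs a positive difference constant. If it is zero then `M = 0`, the gap vanishes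
  -- and the event is everything.
  rcases (by positivity : 0 ≤ 2 * β + M / m).eq_or_lt with hc | hc
  · have hβ' : β = 0 := by
      have : 0 ≤ M / m := by positivity
      linarith
    have hM' : M = 0 := by
      have : M / m = 0 := by linarith
      simpa [hm'.ne'] using this
    have huniv : {S | F S ≤ β + (2 * m * β + M) * s} = Set.univ := by
      refine Set.eq_univ_of_forall fun S => ?_
      have := (abs_le.1 (hFR S)).2
      simp only [Set.mem_ofPred_eq, hβ', hM'] at this ⊢
      linarith
    rw [huniv, measure_univ]
    exact ENNReal.ofReal_le_one.2 (by linarith [hδ.1])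
  · have hset : MeasurableSet {S | F S ≤ β + (2 * m * β + M) * s} :=
      measurableSet_le hF measurable_const
    have htail := measure_ge_le_of_bounded_differences 𝔻 hc hm hF hFR hd
      (ε := (2 * m * β + M) * s) (by positivity)
    -- Since `2 * β + M / m = (2 * m * β + M) / m`, this choice of deviation makes the tail exactly
    -- `δ`.
    have hexp : Real.exp (-2 * ((2 * m * β + M) * s) ^ 2 / (m * (2 * β + M / m) ^ 2)) = δ := by
      have h1 : (2 * β + M / m) = (2 * m * β + M) / m := by field_simp
      have h2 : (2 * m * β + M) ≠ 0 := by
        intro h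
        rw [h1, h] at hc
        simp at hc
      rw [h1, mul_pow, hs, Real.sq_sqrt hlog]
      have h3 : -2 * ((2 * m * β + M) ^ 2 * (Real.log (1 / δ) / (2 * m)))
          / (m * ((2 * m * β + M) / m) ^ 2) = -Real.log (1 / δ) := by
        field_simp
      rw [h3, one_div, Real.log_inv, neg_neg, Real.exp_log hδ.1]
    rw [hexp] at htail
    have hcompl : (Measure.pi fun _ => 𝔻).real {S | F S ≤ β + (2 * m * β + M) * s}ᶜ ≤ δ := by
      refine (measureReal_mono ?_).trans htail
      intro S hS
      simp only [Set.mem_compl_iff, Set.mem_ofPred_eq, not_le] at hS ⊢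
      linarith
    rw [probReal_compl_eq_one_sub hset] at hcompl
    rw [← ofReal_measureReal]
    exact ENNReal.ofReal_le_ofReal (by linarith)

end Concentration

namespace NoisyQNN

open Matrix

/-! ### Pauli rotations in closed form. -/

section Rotations

variable {N : ℕ}

theorem onQubit_mul (q : Fin N) (A B : Matrix (Fin 2) (Fin 2) ℂ) :
    onQubit q A * onQubit q B = onQubit q (A * B) := by
  ext s t
  simp only [Matrix.mul_apply, onQubit, Matrix.of_apply]
  have hinj : Function.Injective fun a => Function.update s q a := Function.update_injective s q
  -- Only intermediate basis states that agree with `s` away from `q` contribute, and these are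
  -- indexed by their value at `q`.
  rw [← Finset.sum_of_injOn (s := Finset.univ)
    (f := fun a => (if ∀ r, r ≠ q → s r = t r then A (s q) a * B a (t q) else 0))
    (fun a => Function.update s q a) hinj.injOn (by simp)]
  · split_ifs <;> simp
  · intro u _ hu
    have : ¬ ∀ r, r ≠ q → s r = u r := by
      intro h
      refine hu ⟨u q, by simp, funext fun r => ?_⟩
      by_cases hr : r = q
      · subst hr; simp
      · simp [hr, h r hr]
    rw [if_neg this, zero_mul]
  · intro a _
    have h1 : ∀ r, r ≠ q → s r = Function.update s q a r := fun r hr => by simp [hr]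
    have h2 : (∀ r, r ≠ q → Function.update s q a r = t r) ↔ ∀ r, r ≠ q → s r = t r :=
      forall₂_congr fun r hr => by simp [hr]
    simp only [if_pos h1, h2]
    split_ifs <;> simp

theorem onQubit_one (q : Fin N) : onQubit q (1 : Matrix (Fin 2) (Fin 2) ℂ) = 1 := by
  ext s t
  simp only [onQubit, Matrix.of_apply, Matrix.one_apply]
  by_cases h : s = t
  · simp [h]
  · rw [if_neg h]
    split_ifs with h1 h2
    · exact absurd (funext fun r => by
        by_cases hr : r = q
        · rw [hr, h2]
        · exact h1 r hr) h
    · rfl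
    · rfl

theorem conjTranspose_onQubit (q : Fin N) (A : Matrix (Fin 2) (Fin 2) ℂ) :
    (onQubit q A)ᴴ = onQubit q Aᴴ := by
  ext s t
  simp only [onQubit, Matrix.of_apply, Matrix.conjTranspose_apply]
  have : (∀ r, r ≠ q → t r = s r) ↔ ∀ r, r ≠ q → s r = t r :=
    forall₂_congr fun r _ => eq_comm
  simp only [this]
  split_ifs <;> simp

theorem Pauli.toMatrix_mul_self (P : Pauli) : P.toMatrix * P.toMatrix = 1 := by
  cases P <;> ext i j <;> fin_cases i <;> fin_cases j <;> simp [Pauli.toMatrix, Matrix.mul_apply]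

theorem Pauli.conjTranspose_toMatrix (P : Pauli) : P.toMatrixᴴ = P.toMatrix := by
  cases P <;> ext i j <;> fin_cases i <;> fin_cases j <;> simp [Pauli.toMatrix]

/-- Even powers of an involution are `1` and odd powers are `A`, so the exponential series splits
into those of `cosh` and `sinh`. -/
theorem exp_smul_of_mul_self_eq_one {n : Type*} [Fintype n] [DecidableEq n] {A : Matrix n n ℂ}
    (hA : A * A = 1) (z : ℂ) :
    NormedSpace.exp (z • A) = Complex.cosh z • (1 : Matrix n n ℂ) + Complex.sinh z • A := by
  have heven : ∀ k : ℕ, A ^ (2 * k) = 1 := fun k => by rw [pow_mul, sq, hA, one_pow]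
  have hodd : ∀ k : ℕ, A ^ (2 * k + 1) = A := fun k => by rw [pow_succ, heven, one_mul]
  rw [NormedSpace.exp_eq_tsum ℂ]
  refine HasSum.tsum_eq (HasSum.even_add_odd ?_ ?_)
  · convert! (Complex.hasSum_cosh z).smul_const (1 : Matrix n n ℂ) using 2 with k
    rw [smul_pow, heven, smul_smul, div_eq_inv_mul]
  · convert! (Complex.hasSum_sinh z).smul_const A using 2 with k
    rw [smul_pow, hodd, smul_smul, div_eq_inv_mul]

theorem pauliRotation_eq (P : Pauli) (q : Fin N) (φ : ℝ) :
    pauliRotation P q φ = (Real.cos (φ / 2) : ℂ) • (1 : Op N)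
      - (Real.sin (φ / 2) * Complex.I : ℂ) • onQubit q P.toMatrix := by
  have hA : onQubit q P.toMatrix * onQubit q P.toMatrix = 1 := by
    rw [onQubit_mul, Pauli.toMatrix_mul_self, onQubit_one]
  rw [pauliRotation, exp_smul_of_mul_self_eq_one hA]
  have h : -(Complex.I * (φ : ℂ) / 2) = -(((φ / 2 : ℝ) : ℂ) * Complex.I) := by
    push_cast; ring
  rw [h, Complex.cosh_neg, Complex.sinh_neg, Complex.cosh_mul_I, Complex.sinh_mul_I,
    ← Complex.ofReal_cos, ← Complex.ofReal_sin, neg_smul, sub_eq_add_neg]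

theorem conjTranspose_pauliRotation (P : Pauli) (q : Fin N) (φ : ℝ) :
    (pauliRotation P q φ)ᴴ = (Real.cos (φ / 2) : ℂ) • (1 : Op N)
      + (Real.sin (φ / 2) * Complex.I : ℂ) • onQubit q P.toMatrix := by
  rw [pauliRotation_eq, conjTranspose_sub, conjTranspose_smul, conjTranspose_smul,
    conjTranspose_onQubit, Pauli.conjTranspose_toMatrix, conjTranspose_one]
  simp [-Complex.ofReal_cos, -Complex.ofReal_sin]

theorem conjTranspose_pauliRotation_mul_self (P : Pauli) (q : Fin N) (φ : ℝ) :
    (pauliRotation P q φ)ᴴ * pauliRotation P q φ = 1 := by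
  have hA : onQubit q P.toMatrix * onQubit q P.toMatrix = 1 := by
    rw [onQubit_mul, Pauli.toMatrix_mul_self, onQubit_one]
  rw [conjTranspose_pauliRotation, pauliRotation_eq]
  simp only [add_mul, mul_sub, smul_mul_assoc, mul_smul_comm, one_mul, mul_one, hA]
  have h : (Real.cos (φ / 2) : ℂ) * Real.cos (φ / 2)
      - (Real.sin (φ / 2) * Complex.I) * (Real.sin (φ / 2) * Complex.I) = 1 := by
    have : (Real.cos (φ / 2) : ℂ) ^ 2 + (Real.sin (φ / 2) : ℂ) ^ 2 = 1 := by
      exact_mod_cast Real.cos_sq_add_sin_sq (φ / 2)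
    linear_combination this - (Real.sin (φ / 2) : ℂ) ^ 2 * Complex.I_sq
  refine Eq.trans (b := ((Real.cos (φ / 2) : ℂ) * Real.cos (φ / 2)
    - (Real.sin (φ / 2) * Complex.I) * (Real.sin (φ / 2) * Complex.I)) • (1 : Op N)) ?_
    (by rw [h, one_smul])
  module

theorem continuous_pauliRotation (P : Pauli) (q : Fin N) :
    Continuous fun φ : ℝ => pauliRotation P q φ := by
  simp_rw [pauliRotation_eq]
  fun_prop

end Rotations

/-! ### Circuits and the effect of the noise. -/

section Gates

variable {N : ℕ} {ι : Type}

theorem Gate.conjTranspose_toOp_mul_self (v : ι → ℝ) (g : Gate N ι) :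
    (g.toOp v)ᴴ * g.toOp v = 1 := by
  cases g with
  | fixed V => exact Matrix.UnitaryGroup.star_mul_self V
  | rotation i P q => exact conjTranspose_pauliRotation_mul_self P q (v i)

theorem Gate.continuous_toOp (g : Gate N ι) : Continuous fun v : ι → ℝ => g.toOp v := by
  cases g with
  | fixed V => exact continuous_const
  | rotation i P q => exact (continuous_pauliRotation P q).comp (continuous_apply i)

theorem Gate.toOp_update_of_ne [DecidableEq ι] {g : Gate N ι} {j : ι} (h : g.coord? ≠ some j)
    (v : ι → ℝ) (u : ℝ) : g.toOp (Function.update v j u) = g.toOp v := by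
  cases g with
  | fixed V => rfl
  | rotation i P q =>
    have : i ≠ j := fun h' => h (by rw [h']; rfl)
    simp [Gate.toOp, this]

/-- The unitary of a circuit, whose gates act from left to right. -/
def circuitOp (v : ι → ℝ) (gs : List (Gate N ι)) : Op N := (gs.map (Gate.toOp v)).reverse.prod

theorem circuitOp_append (v : ι → ℝ) (gs hs : List (Gate N ι)) :
    circuitOp v (gs ++ hs) = circuitOp v hs * circuitOp v gs := by
  simp [circuitOp]

theorem circuitOp_cons (v : ι → ℝ) (g : Gate N ι) (gs : List (Gate N ι)) :
    circuitOp v (g :: gs) = circuitOp v gs * g.toOp v := by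
  simp [circuitOp]

theorem continuous_circuitOp (gs : List (Gate N ι)) :
    Continuous fun v : ι → ℝ => circuitOp v gs := by
  induction gs with
  | nil => exact continuous_const
  | cons g gs ih =>
    simp_rw [circuitOp_cons]
    exact ih.mul g.continuous_toOp

theorem conjTranspose_circuitOp_mul_self (v : ι → ℝ) (gs : List (Gate N ι)) :
    (circuitOp v gs)ᴴ * circuitOp v gs = 1 := by
  induction gs with
  | nil => simp [circuitOp]
  | cons g gs ih =>
    rw [circuitOp_cons, conjTranspose_mul, Matrix.mul_assoc, ← Matrix.mul_assoc _ _ (g.toOp v), ih,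
      Matrix.one_mul, g.conjTranspose_toOp_mul_self]

theorem circuitOp_update_of_notMem [DecidableEq ι] {gs : List (Gate N ι)} {j : ι}
    (h : j ∉ gs.filterMap Gate.coord?) (v : ι → ℝ) (u : ℝ) :
    circuitOp (Function.update v j u) gs = circuitOp v gs := by
  unfold circuitOp
  congr 2
  refine List.map_congr_left fun g hg => Gate.toOp_update_of_ne (fun hj => h ?_) v u
  exact List.mem_filterMap.2 ⟨g, hg, hj⟩

/-- With depolarizing noise of level `p` after each gate, a circuit of `n` gates outputs the
noiseless state with weight `(1 - p) ^ n`, mixed with the maximally mixed state. -/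
theorem foldl_depolarize (p : ℝ) (v : ι → ℝ) (gs : List (Gate N ι)) (ρ : Op N) :
    (gs.map (Gate.toOp v)).foldl (fun ρ U => depolarize p (U * ρ * Uᴴ)) ρ
      = (((1 - p) ^ gs.length : ℝ) : ℂ) • (circuitOp v gs * ρ * (circuitOp v gs)ᴴ)
        + (((1 - (1 - p) ^ gs.length : ℝ) : ℂ) * ρ.trace / 2 ^ N) • (1 : Op N) := by
  induction gs generalizing ρ with
  | nil => simp [circuitOp]
  | cons g gs ih =>
    have hU := g.conjTranspose_toOp_mul_self v
    have hV := mul_eq_one_comm.1 (conjTranspose_circuitOp_mul_self v gs)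
    have htr : (g.toOp v * ρ * (g.toOp v)ᴴ).trace = ρ.trace := by
      rw [Matrix.trace_mul_comm, ← Matrix.mul_assoc, hU, Matrix.one_mul]
    have hone : (1 : Op N).trace = 2 ^ N := by simp [Matrix.trace_one]
    rw [Matrix.mul_assoc] at htr
    rw [List.map_cons, List.foldl_cons, ih, circuitOp_cons]
    simp only [depolarize, htr, trace_add, trace_smul, hone, conjTranspose_mul, Matrix.mul_add,
      Matrix.add_mul, Matrix.mul_smul, Matrix.smul_mul, Matrix.mul_one, hV, smul_add, smul_smul,
      Matrix.mul_assoc, add_assoc, ← add_smul, List.length_cons, smul_eq_mul]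
    congr 2
    · push_cast; ring
    · push_cast; field_simp; ring

end Gates

/-! ### Expectation values: boundedness and dependence on a single angle. -/

section Expectation

variable {N : ℕ} {ι : Type}

theorem opNorm_nonneg (A : Op N) : 0 ≤ opNorm A := norm_nonneg _

open scoped MatrixOrder in
-- Writing `ρ = C* C` and letting `x k` be the conjugated rows of `C`, one has `tr (ρ A) = ∑ ⟪x k, A
-- x k⟫` and `tr ρ = ∑ ‖x k‖ ^ 2`; Cauchy–Schwarz applies term by term.
theorem abs_re_trace_mul_le {ρ : Op N} (hρ : ρ.PosSemidef) (A : Op N) :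
    |(ρ * A).trace.re| ≤ opNorm A * ρ.trace.re := by
  obtain ⟨C, rfl⟩ := CStarAlgebra.nonneg_iff_eq_star_mul_self.mp hρ.nonneg
  set x : Basis N → EuclideanSpace ℂ (Basis N) := fun k => WithLp.toLp 2 (star (C k)) with hx
  have h1 : (star C * C * A).trace
      = ∑ k, inner ℂ (x k) (Matrix.toEuclideanCLM (𝕜 := ℂ) A (x k)) := by
    rw [Matrix.mul_assoc, Matrix.trace_mul_comm, Matrix.mul_assoc]
    simp only [Matrix.trace, hx, Matrix.toEuclideanCLM_toLp, EuclideanSpace.inner_toLp_toLp,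
      star_star]
    refine Finset.sum_congr rfl fun k _ => ?_
    rw [dotProduct_comm]
    rfl
  have h2 : (star C * C).trace.re = ∑ k, ‖x k‖ ^ 2 := by
    rw [Matrix.trace_mul_comm, Matrix.trace, Complex.re_sum]
    refine Finset.sum_congr rfl fun k _ => ?_
    have : (C * star C) k k = inner ℂ (x k) (x k) := by
      simp only [hx, EuclideanSpace.inner_toLp_toLp, star_star]
      rw [dotProduct_comm]
      rfl
    rw [Matrix.diag_apply, this, inner_self_eq_norm_sq_to_K]
    norm_cast
  rw [h1, h2, Finset.mul_sum]
  refine (Complex.abs_re_le_norm _).trans ((norm_sum_le _ _).trans ?_)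
  refine Finset.sum_le_sum fun k _ => (norm_inner_le_norm _ _).trans ?_
  calc ‖x k‖ * ‖Matrix.toEuclideanCLM (𝕜 := ℂ) A (x k)‖ ≤ ‖x k‖ * (opNorm A * ‖x k‖) := by
        gcongr
        exact ContinuousLinearMap.le_opNorm _ _
    _ = _ := by ring

/-- The expectation value of `A` after a noiseless circuit. -/
def circuitExp (v : ι → ℝ) (gs : List (Gate N ι)) (ρ A : Op N) : ℝ :=
  (circuitOp v gs * ρ * (circuitOp v gs)ᴴ * A).trace.re

theorem abs_circuitExp_le (v : ι → ℝ) (gs : List (Gate N ι)) {ρ : Op N} (hρ : ρ.PosSemidef)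
    (hρ1 : ρ.trace = 1) (A : Op N) : |circuitExp v gs ρ A| ≤ opNorm A := by
  refine (abs_re_trace_mul_le (hρ.mul_mul_conjTranspose_same (circuitOp v gs)) A).trans ?_
  rw [Matrix.trace_mul_comm, ← Matrix.mul_assoc, conjTranspose_circuitOp_mul_self, Matrix.one_mul,
    hρ1]
  simp

theorem continuous_circuitExp (gs : List (Gate N ι)) (ρ A : Op N) :
    Continuous fun v : ι → ℝ => circuitExp v gs ρ A := by
  have h := continuous_circuitOp gs
  unfold circuitExp
  exact Complex.continuous_re.comp
    (((h.mul continuous_const).mul h.matrix_conjTranspose).mul continuous_const).matrix_trace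

/-- The rotation is linear in `cos (u / 2)` and `sin (u / 2)`, so conjugation is quadratic in them,
and the double-angle formulas leave only `1`, `cos u` and `sin u`. -/
theorem trace_pauliRotation_conj (P : Pauli) (q : Fin N) (ρ A : Op N) :
    ∃ a b c : ℝ, ∀ u : ℝ, (pauliRotation P q u * ρ * (pauliRotation P q u)ᴴ * A).trace.re
      = a + b * Real.cos u + c * Real.sin u := by
  set X := onQubit q P.toMatrix with hX
  refine ⟨((ρ * A).trace.re + (X * ρ * X * A).trace.re) / 2,
    ((ρ * A).trace.re - (X * ρ * X * A).trace.re) / 2,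
    (Complex.I * ((ρ * X * A).trace - (X * ρ * A).trace)).re / 2, fun u => ?_⟩
  have hexp : pauliRotation P q u * ρ * (pauliRotation P q u)ᴴ * A
      = ((Real.cos (u / 2) ^ 2 : ℝ) : ℂ) • (ρ * A)
        + ((Real.sin (u / 2) ^ 2 : ℝ) : ℂ) • (X * ρ * X * A)
        + (((Real.sin (u / 2) * Real.cos (u / 2) : ℝ) : ℂ) * Complex.I)
          • (ρ * X * A - X * ρ * A) := by
    rw [conjTranspose_pauliRotation, pauliRotation_eq]
    simp only [← hX, Matrix.sub_mul, Matrix.mul_add, Matrix.add_mul, Matrix.smul_mul,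
      Matrix.mul_smul, Matrix.one_mul, Matrix.mul_one]
    match_scalars
    all_goals ring_nf
    all_goals simp
  have hc : Real.cos (u / 2) ^ 2 = (1 + Real.cos u) / 2 := by
    have := Real.cos_sq (u / 2)
    rw [mul_div_cancel₀ u two_ne_zero] at this
    linarith
  have hs : Real.sin (u / 2) ^ 2 = (1 - Real.cos u) / 2 := by
    rw [Real.sin_sq, hc]; ring
  have hsc : Real.sin (u / 2) * Real.cos (u / 2) = Real.sin u / 2 := by
    have := Real.sin_two_mul (u / 2)
    rw [mul_div_cancel₀ u two_ne_zero] at this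
    linarith
  rw [hexp, hc, hs, hsc, trace_add, trace_add, trace_smul, trace_smul, trace_smul, trace_sub,
    smul_eq_mul, smul_eq_mul, smul_eq_mul, mul_assoc _ Complex.I, Complex.add_re, Complex.add_re,
    Complex.re_ofReal_mul, Complex.re_ofReal_mul, Complex.re_ofReal_mul]
  ring

theorem exists_split_of_count_eq_one [DecidableEq ι] {gs : List (Gate N ι)} {j : ι}
    (h : (gs.filterMap Gate.coord?).count j = 1) :
    ∃ (l₁ l₂ : List (Gate N ι)) (P : Pauli) (q : Fin N), gs = l₁ ++ Gate.rotation j P q :: l₂ ∧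
      j ∉ l₁.filterMap Gate.coord? ∧ j ∉ l₂.filterMap Gate.coord? := by
  have hmem : j ∈ gs.filterMap Gate.coord? := by
    rw [← List.count_pos_iff, h]; exact one_pos
  obtain ⟨g, hg, hgj⟩ := List.mem_filterMap.1 hmem
  obtain ⟨l₁, l₂, rfl⟩ := List.append_of_mem hg
  cases g with
  | fixed V => simp [Gate.coord?] at hgj
  | rotation i P q =>
    obtain rfl : i = j := by simpa [Gate.coord?] using hgj
    have hc : (Gate.rotation i P q : Gate N ι).coord? = some i := rfl
    refine ⟨l₁, l₂, P, q, rfl, ?_, ?_⟩ <;>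
    · rw [List.filterMap_append, List.filterMap_cons_some hc, List.count_append,
        List.count_cons_self] at h
      rw [← List.count_eq_zero]
      omega

/-- The angle `j` enters through one gate only. The gates before it are absorbed into the state and
those after it, by cyclicity of the trace, into the observable. -/
theorem circuitExp_update [DecidableEq ι] {gs : List (Gate N ι)} {j : ι}
    (h : (gs.filterMap Gate.coord?).count j = 1) (v : ι → ℝ) (ρ A : Op N) :
    ∃ a b c : ℝ, ∀ u : ℝ, circuitExp (Function.update v j u) gs ρ A
      = a + b * Real.cos u + c * Real.sin u := by
  obtain ⟨l₁, l₂, P, q, rfl, h₁, h₂⟩ := exists_split_of_count_eq_one h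
  obtain ⟨a, b, c, habc⟩ := trace_pauliRotation_conj P q
    (circuitOp v l₁ * ρ * (circuitOp v l₁)ᴴ) ((circuitOp v l₂)ᴴ * A * circuitOp v l₂)
  refine ⟨a, b, c, fun u => ?_⟩
  have hu : circuitOp (Function.update v j u) (l₁ ++ Gate.rotation j P q :: l₂)
      = circuitOp v l₂ * pauliRotation P q u * circuitOp v l₁ := by
    rw [circuitOp_append, circuitOp_cons, circuitOp_update_of_notMem h₁,
      circuitOp_update_of_notMem h₂, Gate.toOp, Function.update_self]
  rw [← habc u, circuitExp, hu]
  generalize circuitOp v l₂ = V₂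
  generalize circuitOp v l₁ = V₁
  generalize pauliRotation P q u = R
  refine congrArg Complex.re ?_
  calc (V₂ * R * V₁ * ρ * (V₂ * R * V₁)ᴴ * A).trace
      = (V₂ * (R * (V₁ * ρ * V₁ᴴ) * Rᴴ * V₂ᴴ * A)).trace := by
        simp only [conjTranspose_mul, Matrix.mul_assoc]
    _ = _ := by
        rw [Matrix.trace_mul_comm]
        simp only [Matrix.mul_assoc]

/-- Parameter-shift rule: `f' x = (f (x + π / 2) - f (x - π / 2)) / 2`, so a bound on `|f|` is also
a bound on `|f'|`. -/
theorem abs_sub_le_of_trig {B a b c : ℝ} {f : ℝ → ℝ}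
    (hf : ∀ u, f u = a + b * Real.cos u + c * Real.sin u) (hB : ∀ u, |f u| ≤ B) (u w : ℝ) :
    |f u - f w| ≤ B * |u - w| := by
  have hd : ∀ x, HasDerivAt f (-(b * Real.sin x) + c * Real.cos x) x := by
    intro x
    have : f = fun u => a + b * Real.cos u + c * Real.sin u := funext hf
    rw [this]
    convert! (((Real.hasDerivAt_cos x).const_mul b).const_add a).add
      ((Real.hasDerivAt_sin x).const_mul c) using 1
    ring
  have hbound : ∀ x, |-(b * Real.sin x) + c * Real.cos x| ≤ B := by
    intro x
    have h1 := hf (x + Real.pi / 2)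
    have h2 := hf (x - Real.pi / 2)
    rw [Real.cos_add_pi_div_two, Real.sin_add_pi_div_two] at h1
    rw [Real.cos_sub_pi_div_two, Real.sin_sub_pi_div_two] at h2
    have h3 := abs_le.1 (hB (x + Real.pi / 2))
    have h4 := abs_le.1 (hB (x - Real.pi / 2))
    exact abs_le.2 ⟨by linarith [h3.1, h4.2], by linarith [h3.2, h4.1]⟩
  exact Convex.norm_image_sub_le_of_norm_hasDerivWithin_le (s := Set.univ)
    (fun x _ => (hd x).hasDerivWithinAt) (fun x _ => hbound x) convex_univ (Set.mem_univ w)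
    (Set.mem_univ u)

end Expectation

/-- The same gate, with its angle read from the coordinate `f i` instead of `i`. -/
def Gate.reindex {N : ℕ} {ι κ : Type} (f : ι → κ) : Gate N ι → Gate N κ
  | .fixed V => .fixed V
  | .rotation i P q => .rotation (f i) P q

theorem Gate.toOp_reindex {N : ℕ} {ι κ : Type} (f : ι → κ) (v : κ → ℝ) (g : Gate N ι) :
    (g.reindex f).toOp v = g.toOp (v ∘ f) := by
  cases g <;> rfl

theorem Gate.coord?_reindex {N : ℕ} {ι κ : Type} (f : ι → κ) (g : Gate N ι) :
    (g.reindex f).coord? = g.coord?.map f := by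
  cases g <;> rfl

theorem filterMap_coord?_reindex {N : ℕ} {ι κ : Type} (f : ι → κ) (gs : List (Gate N ι)) :
    (gs.map (Gate.reindex f)).filterMap Gate.coord? = (gs.filterMap Gate.coord?).map f := by
  rw [List.filterMap_map, List.map_filterMap]
  congr 1
  funext g
  exact g.coord?_reindex f

/-! ### The data re-uploading circuit: gate count, damping and Lipschitz bounds. -/

namespace DataReuploadingQNN

variable {N K D L : ℕ} (Q : DataReuploadingQNN N K D L)

/-- All gates of the circuit, as functions of the joint vector of parameters and features. -/
def circuit : List (Gate N (Fin K ⊕ Fin D)) :=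
  (Q.trainable 0).map (Gate.reindex Sum.inl) ++
    (List.ofFn fun l : Fin L => Q.encoding.map (Gate.reindex Sum.inr) ++
      (Q.trainable l.succ).map (Gate.reindex Sum.inl)).flatten

theorem gates_eq (θ : Fin K → ℝ) (x : Fin D → ℝ) :
    Q.gates θ x = Q.circuit.map (Gate.toOp (Sum.elim θ x)) := by
  simp only [gates, circuit, List.map_append, List.map_map, List.map_flatten, List.map_ofFn]
  have h1 : (Gate.toOp (Sum.elim θ x) : Gate N (Fin K ⊕ Fin D) → Op N) ∘ Gate.reindex Sum.inl
      = Gate.toOp θ := funext fun g => by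
    rw [Function.comp_apply, Gate.toOp_reindex, Sum.elim_comp_inl]
  have h2 : (Gate.toOp (Sum.elim θ x) : Gate N (Fin K ⊕ Fin D) → Op N) ∘ Gate.reindex Sum.inr
      = Gate.toOp x := funext fun g => by
    rw [Function.comp_apply, Gate.toOp_reindex, Sum.elim_comp_inr]
  rw [h1]
  congr 3
  funext l
  simp [h1, h2]

theorem filterMap_coord?_circuit :
    Q.circuit.filterMap Gate.coord? = ((Q.trainable 0).filterMap Gate.coord?).map Sum.inl ++
      (List.ofFn fun l : Fin L => (Q.encoding.filterMap Gate.coord?).map Sum.inr ++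
        ((Q.trainable l.succ).filterMap Gate.coord?).map Sum.inl).flatten := by
  rw [circuit, List.filterMap_append, List.filterMap_flatten, List.map_ofFn,
    filterMap_coord?_reindex]
  congr 3
  funext l
  rw [Function.comp_apply, List.filterMap_append, filterMap_coord?_reindex,
    filterMap_coord?_reindex]

/-- Stated for any additive, permutation-invariant `φ` so that it serves both for the multiplicity
of a parameter and for the number of rotations. -/
theorem sum_trainable {φ : List (Fin K) → ℕ} (h0 : φ [] = 0)
    (hφ : ∀ l₁ l₂, φ (l₁ ++ l₂) = φ l₁ + φ l₂) (hperm : ∀ l₁ l₂, l₁.Perm l₂ → φ l₁ = φ l₂) :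
    φ ((Q.trainable 0).filterMap Gate.coord?)
      + ∑ l : Fin L, φ ((Q.trainable l.succ).filterMap Gate.coord?) = φ (List.finRange K) := by
  have hflat : ∀ ls : List (List (Fin K)), φ ls.flatten = (ls.map φ).sum := by
    intro ls
    induction ls with
    | nil => simpa using h0
    | cons l ls ih => simp [hφ, ih]
  rw [← hperm _ _ Q.trainable_perm, List.filterMap_flatten, hflat, List.map_ofFn, List.map_ofFn,
    List.sum_ofFn, Fin.sum_univ_succ]
  rfl

theorem count_circuit [BEq (Fin K ⊕ Fin D)] [LawfulBEq (Fin K ⊕ Fin D)] (j : Fin K) :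
    (Q.circuit.filterMap Gate.coord?).count (Sum.inl j) = 1 := by
  have hinl : ∀ l : List (Fin K), (l.map (Sum.inl : Fin K → Fin K ⊕ Fin D)).count (Sum.inl j)
      = l.count j := fun l => List.count_map_of_injective l _ Sum.inl_injective j
  have hinr : ∀ l : List (Fin D), (l.map (Sum.inr : Fin D → Fin K ⊕ Fin D)).count (Sum.inl j)
      = 0 := fun l => List.count_eq_zero.2 (by simp)
  rw [filterMap_coord?_circuit, List.count_append, List.count_flatten, List.map_ofFn,
    List.sum_ofFn, hinl]
  simp only [Function.comp_apply, List.count_append, hinl, hinr, zero_add]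
  rw [Q.sum_trainable (φ := List.count j) (by simp) (fun _ _ => List.count_append)
    fun _ _ h => h.count_eq j]
  exact List.count_eq_one_of_mem (List.nodup_finRange K) (List.mem_finRange j)

/-- Rotations alone account for `L * D + K` gates; fixed gates only lengthen the circuit and so
increase the damping. -/
theorem le_length_circuit : L * D + K ≤ Q.circuit.length := by
  refine le_trans (le_of_eq ?_) (List.length_filterMap_le Gate.coord? Q.circuit)
  have hD : (Q.encoding.filterMap Gate.coord?).length = D := by
    simpa using Q.encoding_perm.length_eq
  rw [filterMap_coord?_circuit, List.length_append, List.length_flatten, List.map_ofFn,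
    List.sum_ofFn]
  simp only [Function.comp_apply, List.length_append, List.length_map, hD,
    Finset.sum_add_distrib, Finset.sum_const, Finset.card_univ, Fintype.card_fin, smul_eq_mul]
  have := Q.sum_trainable (φ := List.length) rfl (fun _ _ => List.length_append)
    fun _ _ h => h.length_eq
  rw [List.length_finRange] at this
  omega

/-- The factor by which the noise damps the signal of the whole circuit. -/
def damping (p : ℝ) : ℝ := (1 - p) ^ Q.circuit.length

theorem output_eq (p : ℝ) (θ : Fin K → ℝ) (x : Fin D → ℝ) :
    Q.output p θ x = Q.damping p * circuitExp (Sum.elim θ x) Q.circuit Q.ρin Q.obs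
      + (1 - Q.damping p) * (Q.obs.trace.re / 2 ^ N) := by
  rw [output, outputState, gates_eq, foldl_depolarize, Q.ρin_trace, Matrix.add_mul,
    Matrix.smul_mul, Matrix.smul_mul, Matrix.one_mul, trace_add, trace_smul, trace_smul,
    Complex.add_re, smul_eq_mul, smul_eq_mul, Complex.re_ofReal_mul, mul_one,
    ← damping]
  congr 1
  have : ((1 - Q.damping p : ℝ) : ℂ) / 2 ^ N = (((1 - Q.damping p) / 2 ^ N : ℝ) : ℂ) := by
    push_cast; rfl
  rw [this, Complex.re_ofReal_mul]
  ring

theorem damping_mem {p : ℝ} (hp : p ∈ Set.Icc (0 : ℝ) 1) : 0 ≤ Q.damping p ∧ Q.damping p ≤ 1 :=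
  ⟨pow_nonneg (by linarith [hp.2]) _, pow_le_one₀ (by linarith [hp.2]) (by linarith [hp.1])⟩

theorem damping_le {p : ℝ} (hp : p ∈ Set.Icc (0 : ℝ) 1) :
    Q.damping p ≤ (1 - p) ^ (L * D) * (1 - p) ^ K := by
  rw [← pow_add]
  exact pow_le_pow_of_le_one (by linarith [hp.2]) (by linarith [hp.1]) Q.le_length_circuit

/-- The output is a convex combination of the expectations of the observable in the noiseless output
state and in the maximally mixed state. -/
theorem output_mem {p : ℝ} (hp : p ∈ Set.Icc (0 : ℝ) 1) (θ : Fin K → ℝ) (x : Fin D → ℝ) :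
    Q.output p θ x ∈ Set.Icc (-opNorm Q.obs) (opNorm Q.obs) := by
  have h1 := abs_circuitExp_le (Sum.elim θ x) Q.circuit Q.ρin_posSemidef Q.ρin_trace Q.obs
  have h2 : |Q.obs.trace.re / 2 ^ N| ≤ opNorm Q.obs := by
    have := abs_re_trace_mul_le (N := N) Matrix.PosSemidef.one Q.obs
    have h1 : (1 : Op N).trace.re = 2 ^ N := by
      rw [Matrix.trace_one, Fintype.card_pi]
      simp only [Fintype.card_fin, Finset.prod_const, Finset.card_univ]
      norm_cast
    rw [h1, Matrix.one_mul] at this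
    rw [abs_div, abs_of_pos (by positivity : (0 : ℝ) < 2 ^ N), div_le_iff₀ (by positivity)]
    exact this
  obtain ⟨hd0, hd1⟩ := Q.damping_mem hp
  rw [Set.mem_Icc, ← abs_le, output_eq]
  refine (abs_add_le _ _).trans ?_
  rw [abs_mul, abs_mul, abs_of_nonneg hd0, abs_of_nonneg (sub_nonneg.2 hd1)]
  nlinarith [mul_le_mul_of_nonneg_left h1 hd0, mul_le_mul_of_nonneg_left h2 (sub_nonneg.2 hd1)]

theorem circuitExp_circuit_update (θ : Fin K → ℝ) (x : Fin D → ℝ) (j : Fin K) :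
    ∃ a b c : ℝ, ∀ u, circuitExp (Sum.elim (Function.update θ j u) x) Q.circuit Q.ρin Q.obs
      = a + b * Real.cos u + c * Real.sin u := by
  obtain ⟨a, b, c, h⟩ := circuitExp_update
    (@count_circuit N K D L Q instBEqOfDecidableEq inferInstance j) (Sum.elim θ x) Q.ρin Q.obs
  exact ⟨a, b, c, fun u => by rw [Sum.elim_update_left, h]⟩

theorem differentiable_output_update (p : ℝ) (θ : Fin K → ℝ) (x : Fin D → ℝ) (j : Fin K) :
    Differentiable ℝ fun u => Q.output p (Function.update θ j u) x := by
  obtain ⟨a, b, c, h⟩ := Q.circuitExp_circuit_update θ x j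
  simp_rw [output_eq, h]
  fun_prop

theorem abs_output_update_sub_le {p : ℝ} (hp : p ∈ Set.Icc (0 : ℝ) 1) (θ : Fin K → ℝ)
    (x : Fin D → ℝ) (j : Fin K) (u w : ℝ) :
    |Q.output p (Function.update θ j u) x - Q.output p (Function.update θ j w) x|
      ≤ Q.damping p * opNorm Q.obs * |u - w| := by
  obtain ⟨a, b, c, h⟩ := Q.circuitExp_circuit_update θ x j
  have := abs_sub_le_of_trig h
    (fun u => abs_circuitExp_le _ Q.circuit Q.ρin_posSemidef Q.ρin_trace Q.obs) u w
  rw [output_eq, output_eq, add_sub_add_right_eq_sub, ← mul_sub, abs_mul,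
    abs_of_nonneg (Q.damping_mem hp).1, mul_assoc]
  exact mul_le_mul_of_nonneg_left this (Q.damping_mem hp).1

theorem continuous_output (p : ℝ) :
    Continuous fun q : (Fin K → ℝ) × (Fin D → ℝ) => Q.output p q.1 q.2 := by
  simp_rw [output_eq]
  have h : Continuous fun q : (Fin K → ℝ) × (Fin D → ℝ) =>
      (Sum.elim q.1 q.2 : Fin K ⊕ Fin D → ℝ) := by
    refine continuous_pi fun i => ?_
    cases i with
    | inl i => exact (continuous_apply i).comp continuous_fst
    | inr i => exact (continuous_apply i).comp continuous_snd
  exact (continuous_const.mul ((continuous_circuitExp Q.circuit Q.ρin Q.obs).comp h)).add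
    continuous_const

end DataReuploadingQNN

/-- A function that is Lipschitz in each coordinate is Lipschitz for the `ℓ¹` distance. -/
theorem abs_sub_le_sum_of_update {ι : Type*} [Fintype ι] [DecidableEq ι] {F : (ι → ℝ) → ℝ}
    {c : ℝ} (hF : ∀ v j u w, |F (Function.update v j u) - F (Function.update v j w)|
      ≤ c * |u - w|) (v v' : ι → ℝ) :
    |F v - F v'| ≤ c * ∑ j, |v j - v' j| := by
  have h : ∀ s : Finset ι, |F (s.piecewise v v') - F v'| ≤ c * ∑ j ∈ s, |v j - v' j| := by
    intro s
    induction s using Finset.induction_on with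
    | empty => simp
    | insert a s ha ih =>
      rw [Finset.piecewise_insert, Finset.sum_insert ha, mul_add]
      have h1 := hF (s.piecewise v v') a (v a) (v' a)
      have h2 : Function.update (s.piecewise v v') a (v' a) = s.piecewise v v' := by
        rw [Function.update_eq_self_iff, Finset.piecewise_eq_of_notMem _ _ _ ha]
      rw [h2] at h1
      exact (abs_sub_le _ _ _).trans (add_le_add h1 ih)
  simpa using h Finset.univ

theorem card_filter_apply_eq_mul {T m : ℕ} (t : Fin T) (i : Fin m) :
    (Finset.univ.filter fun ω : Fin T → Fin m => ω t = i).card * m = m ^ T := by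
  -- The draws with `ω t = i` form a product set with a singleton in slot `t` and everything
  -- elsewhere.
  have h : (Finset.univ.filter fun ω : Fin T → Fin m => ω t = i)
      = Fintype.piFinset (Function.update (fun _ => Finset.univ) t ({i} : Finset (Fin m))) := by
    ext ω
    simp only [Finset.mem_filter, Finset.mem_univ, true_and, Fintype.mem_piFinset]
    refine ⟨fun h s => ?_, fun h => by simpa using h t⟩
    by_cases hs : s = t
    · subst hs; simp [h]
    · simp [hs]
  have hcard : ∀ s, (Function.update (fun _ : Fin T => (Finset.univ : Finset (Fin m))) t
      ({i} : Finset (Fin m)) s).card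
      = Function.update (fun _ => m) t 1 s := by
    intro s
    by_cases hs : s = t
    · subst hs; simp
    · simp [hs]
  rw [h, Fintype.card_piFinset, Finset.prod_congr rfl fun s _ => hcard s,
    Finset.prod_update_of_mem (Finset.mem_univ t), one_mul, Finset.prod_const,
    ← pow_succ, Finset.card_univ_sdiff]
  congr 1
  have := t.pos
  simp
  omega

/-- A fixed index is drawn in `T` uniform draws with probability at most `T / m`. -/
theorem card_filter_exists_eq_div_le {T m : ℕ} (i : Fin m) :
    ((Finset.univ.filter fun ω : Fin T → Fin m => ∃ t, ω t = i).card : ℝ) / (m : ℝ) ^ T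
      ≤ T / m := by
  have hm : (0 : ℝ) < m := by exact_mod_cast i.pos
  have h1 : (Finset.univ.filter fun ω : Fin T → Fin m => ∃ t, ω t = i).card
      ≤ ∑ t : Fin T, (Finset.univ.filter fun ω : Fin T → Fin m => ω t = i).card := by
    refine (Finset.card_le_card ?_).trans Finset.card_biUnion_le
    intro ω hω
    simpa using hω
  rw [div_le_div_iff₀ (by positivity) hm]
  have h2 : (Finset.univ.filter fun ω : Fin T → Fin m => ∃ t, ω t = i).card * m ≤ T * m ^ T := by
    refine (Nat.mul_le_mul_right m h1).trans (le_of_eq ?_)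
    rw [Finset.sum_mul, Finset.sum_congr rfl fun t _ => card_filter_apply_eq_mul t i]
    simp
  exact_mod_cast h2

/-! ### Stability and measurability of stochastic gradient descent. -/

namespace DataReuploadingQNN

variable {N K D L : ℕ} (Q : DataReuploadingQNN N K D L) {p : ℝ} {ℓ : ℝ → ℝ → ℝ} {𝒴 : Set ℝ}
  {C₁ C₂ : ℝ}

theorem abs_loss_update_sub_le (hp : p ∈ Set.Icc (0 : ℝ) 1) (hC₁ : 0 ≤ C₁)
    (hℓ : IsLipschitzSmooth ℓ 𝒴 (opNorm Q.obs) C₁ C₂) {y : ℝ} (hy : y ∈ 𝒴) (x : Fin D → ℝ)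
    (θ : Fin K → ℝ) (j : Fin K) (u w : ℝ) :
    |ℓ (Q.output p (Function.update θ j u) x) y - ℓ (Q.output p (Function.update θ j w) x) y|
      ≤ C₁ * (Q.damping p * opNorm Q.obs) * |u - w| := by
  refine (hℓ.lipschitz y hy _ (Q.output_mem hp _ x) _ (Q.output_mem hp _ x)).trans ?_
  rw [mul_assoc C₁]
  exact mul_le_mul_of_nonneg_left (Q.abs_output_update_sub_le hp θ x j u w) hC₁

theorem lipschitz_const_nonneg (hp : p ∈ Set.Icc (0 : ℝ) 1) (hC₁ : 0 ≤ C₁) :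
    0 ≤ C₁ * (Q.damping p * opNorm Q.obs) :=
  mul_nonneg hC₁ (mul_nonneg (Q.damping_mem hp).1 (opNorm_nonneg _))

theorem abs_deriv_loss_le (hp : p ∈ Set.Icc (0 : ℝ) 1) (hC₁ : 0 ≤ C₁)
    (hℓ : IsLipschitzSmooth ℓ 𝒴 (opNorm Q.obs) C₁ C₂) {y : ℝ} (hy : y ∈ 𝒴) (x : Fin D → ℝ)
    (θ : Fin K → ℝ) (j : Fin K) (u : ℝ) :
    |deriv (fun u => ℓ (Q.output p (Function.update θ j u) x) y) u|
      ≤ C₁ * (Q.damping p * opNorm Q.obs) := by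
  have hlip : LipschitzWith ⟨_, Q.lipschitz_const_nonneg hp hC₁⟩
      (fun u => ℓ (Q.output p (Function.update θ j u) x) y) :=
    LipschitzWith.of_dist_le_mul fun u w =>
      Q.abs_loss_update_sub_le hp hC₁ hℓ hy x θ j u w
  exact norm_deriv_le_of_lipschitz hlip

theorem differentiableAt_loss_update (hp : p ∈ Set.Icc (0 : ℝ) 1)
    (hℓ : IsLipschitzSmooth ℓ 𝒴 (opNorm Q.obs) C₁ C₂) {y : ℝ} (hy : y ∈ 𝒴) (x : Fin D → ℝ)
    (θ : Fin K → ℝ) (j : Fin K) (u : ℝ) :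
    DifferentiableAt ℝ (fun u => ℓ (Q.output p (Function.update θ j u) x) y) u :=
  DifferentiableAt.comp (g := fun a => ℓ a y) u
    (hℓ.differentiable y hy _ (Q.output_mem hp (Function.update θ j u) x))
    (Q.differentiable_output_update p θ x j u)

/-- Partial derivatives of the loss are bounded by `κ` everywhere, so a single step moves a
coordinate by at most `η κ`, wherever the run happens to be. -/
theorem abs_foldl_sgdStep_sub_le (hp : p ∈ Set.Icc (0 : ℝ) 1) (hC₁ : 0 ≤ C₁)
    (hℓ : IsLipschitzSmooth ℓ 𝒴 (opNorm Q.obs) C₁ C₂) {η : ℝ} (hη : 0 ≤ η) {m : ℕ}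
    {S : Fin m → (Fin D → ℝ) × ℝ} (hS : ∀ i, (S i).2 ∈ 𝒴) (is : List (Fin m)) (θ : Fin K → ℝ)
    (j : Fin K) :
    |is.foldl (fun θ i => Q.sgdStep p ℓ η (S i) θ) θ j - θ j|
      ≤ is.length * (η * (C₁ * (Q.damping p * opNorm Q.obs))) := by
  induction is generalizing θ with
  | nil => simp
  | cons i is ih =>
    rw [List.foldl_cons, List.length_cons]
    have hstep : |Q.sgdStep p ℓ η (S i) θ j - θ j|
        ≤ η * (C₁ * (Q.damping p * opNorm Q.obs)) := by
      rw [sgdStep, sub_sub_cancel_left, abs_neg, abs_mul, abs_of_nonneg hη]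
      exact mul_le_mul_of_nonneg_left (Q.abs_deriv_loss_le hp hC₁ hℓ (hS i) _ θ j _) hη
    refine (abs_sub_le _ (Q.sgdStep p ℓ η (S i) θ j) _).trans
      ((add_le_add (ih _) hstep).trans (le_of_eq ?_))
    push_cast
    ring

theorem foldl_sgdStep_update {η : ℝ} {m : ℕ} (S : Fin m → (Fin D → ℝ) × ℝ) (i : Fin m)
    (w : (Fin D → ℝ) × ℝ) {is : List (Fin m)} (hi : i ∉ is) (θ : Fin K → ℝ) :
    is.foldl (fun θ k => Q.sgdStep p ℓ η (Function.update S i w k) θ) θ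
      = is.foldl (fun θ k => Q.sgdStep p ℓ η (S k) θ) θ := by
  refine List.foldl_ext _ _ _ fun θ k hk => ?_
  have hki : k ≠ i := fun h => hi (h ▸ hk)
  rw [Function.update_of_ne hki]

/-- Replacing one sample moves the loss after a run of stochastic gradient descent by a bounded
amount, and only if that sample is drawn. -/
theorem abs_loss_sgd_update_sub_le (hp : p ∈ Set.Icc (0 : ℝ) 1) (hC₁ : 0 ≤ C₁)
    (hℓ : IsLipschitzSmooth ℓ 𝒴 (opNorm Q.obs) C₁ C₂) {η : ℝ} (hη : 0 ≤ η) {m T : ℕ}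
    {S : Fin m → (Fin D → ℝ) × ℝ} (hS : ∀ i, (S i).2 ∈ 𝒴) (i : Fin m) {w : (Fin D → ℝ) × ℝ}
    (hw : w.2 ∈ 𝒴) (ω : Fin T → Fin m) (θ₀ : Fin K → ℝ) {z : (Fin D → ℝ) × ℝ} (hz : z.2 ∈ 𝒴) :
    |ℓ (Q.output p (Q.sgd p ℓ η (Function.update S i w) ω θ₀) z.1) z.2
        - ℓ (Q.output p (Q.sgd p ℓ η S ω θ₀) z.1) z.2|
      ≤ if ∃ t, ω t = i then
          C₁ * (Q.damping p * opNorm Q.obs)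
            * (K * (2 * (T * (η * (C₁ * (Q.damping p * opNorm Q.obs))))))
        else 0 := by
  set κ := C₁ * (Q.damping p * opNorm Q.obs) with hκ
  split_ifs with h
  · refine (abs_sub_le_sum_of_update (F := fun θ => ℓ (Q.output p θ z.1) z.2)
      (fun v j u w => Q.abs_loss_update_sub_le hp hC₁ hℓ hz z.1 v j u w) _ _).trans ?_
    refine mul_le_mul_of_nonneg_left ?_ (Q.lipschitz_const_nonneg hp hC₁)
    have hS' : ∀ k, (Function.update S i w k).2 ∈ 𝒴 := by
      intro k
      by_cases hk : k = i
      · subst hk; simpa using hw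
      · simpa [hk] using hS k
    -- The two runs are compared through their common starting point, which gives the factor `2`.
    have hj : ∀ j, |Q.sgd p ℓ η (Function.update S i w) ω θ₀ j - Q.sgd p ℓ η S ω θ₀ j|
        ≤ 2 * (T * (η * κ)) := by
      intro j
      have h1 := Q.abs_foldl_sgdStep_sub_le hp hC₁ hℓ hη hS' (List.ofFn ω) θ₀ j
      have h2 := Q.abs_foldl_sgdStep_sub_le hp hC₁ hℓ hη hS (List.ofFn ω) θ₀ j
      rw [List.length_ofFn] at h1 h2
      rw [abs_sub_comm] at h2
      refine (abs_sub_le _ (θ₀ j) _).trans ((add_le_add h1 h2).trans (le_of_eq ?_))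
      ring
    refine (Finset.sum_le_sum fun j _ => hj j).trans (le_of_eq ?_)
    simp
  · have : Q.sgd p ℓ η (Function.update S i w) ω θ₀ = Q.sgd p ℓ η S ω θ₀ :=
      Q.foldl_sgdStep_update S i w (by simpa [List.mem_ofFn] using h) θ₀
    rw [this, sub_self, abs_zero]

theorem abs_average_loss_sgd_update_sub_le (hp : p ∈ Set.Icc (0 : ℝ) 1) (hC₁ : 0 ≤ C₁)
    (hℓ : IsLipschitzSmooth ℓ 𝒴 (opNorm Q.obs) C₁ C₂) {η : ℝ} (hη : 0 ≤ η) {m T : ℕ}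
    {S : Fin m → (Fin D → ℝ) × ℝ} (hS : ∀ i, (S i).2 ∈ 𝒴) (i : Fin m) {w : (Fin D → ℝ) × ℝ}
    (hw : w.2 ∈ 𝒴) (θ₀ : Fin K → ℝ) {z : (Fin D → ℝ) × ℝ} (hz : z.2 ∈ 𝒴) :
    |(∑ ω : Fin T → Fin m, ℓ (Q.output p (Q.sgd p ℓ η (Function.update S i w) ω θ₀) z.1) z.2)
          / (m : ℝ) ^ T
        - (∑ ω : Fin T → Fin m, ℓ (Q.output p (Q.sgd p ℓ η S ω θ₀) z.1) z.2) / (m : ℝ) ^ T|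
      ≤ T / m * (C₁ * (Q.damping p * opNorm Q.obs)
            * (K * (2 * (T * (η * (C₁ * (Q.damping p * opNorm Q.obs))))))) := by
  have hκ := Q.lipschitz_const_nonneg hp hC₁
  set κ := C₁ * (Q.damping p * opNorm Q.obs)
  have hm : (0 : ℝ) < (m : ℝ) ^ T := pow_pos (by exact_mod_cast i.pos) T
  rw [← sub_div, ← Finset.sum_sub_distrib, abs_div, abs_of_pos hm]
  calc _ ≤ (∑ ω : Fin T → Fin m, if ∃ t, ω t = i then κ * (K * (2 * (T * (η * κ)))) else 0)
        / (m : ℝ) ^ T := by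
        refine div_le_div_of_nonneg_right ?_ hm.le
        exact (Finset.abs_sum_le_sum_abs _ _).trans (Finset.sum_le_sum fun ω _ =>
          Q.abs_loss_sgd_update_sub_le hp hC₁ hℓ hη hS i hw ω θ₀ hz)
    _ = ((Finset.univ.filter fun ω : Fin T → Fin m => ∃ t, ω t = i).card : ℝ) / (m : ℝ) ^ T
        * (κ * (K * (2 * (T * (η * κ))))) := by
        rw [← Finset.sum_filter, Finset.sum_const, nsmul_eq_mul]
        ring
    _ ≤ _ := mul_le_mul_of_nonneg_right (card_filter_exists_eq_div_le i) (by positivity)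

theorem measurable_loss (p : ℝ) (hℓm : Measurable (Function.uncurry ℓ)) {X : Type*}
    [MeasurableSpace X] {θ : X → Fin K → ℝ} {z : X → (Fin D → ℝ) × ℝ} (hθ : Measurable θ)
    (hz : Measurable z) : Measurable fun a => ℓ (Q.output p (θ a) (z a).1) (z a).2 :=
  hℓm.comp (((Q.continuous_output p).measurable.comp (hθ.prodMk hz.fst)).prodMk hz.snd)

/-- The partial derivative is the pointwise limit of difference quotients with increments `1 / (n +
1)`. Convergence at every point uses that all labels lie in `𝒴`. -/
theorem measurable_sgdStep (hp : p ∈ Set.Icc (0 : ℝ) 1)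
    (hℓ : IsLipschitzSmooth ℓ 𝒴 (opNorm Q.obs) C₁ C₂) (hℓm : Measurable (Function.uncurry ℓ))
    (η : ℝ) {X : Type*} [MeasurableSpace X] {θ : X → Fin K → ℝ} {z : X → (Fin D → ℝ) × ℝ}
    (hθ : Measurable θ) (hz : Measurable z) (hz𝒴 : ∀ a, (z a).2 ∈ 𝒴) :
    Measurable fun a => Q.sgdStep p ℓ η (z a) (θ a) := by
  refine measurable_pi_iff.2 fun j => ?_
  have hθj : Measurable fun a => θ a j := (measurable_pi_apply j).comp hθ
  refine hθj.sub (Measurable.const_mul ?_ η)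
  have hq : ∀ t : ℝ, Measurable fun a => t⁻¹ *
      (ℓ (Q.output p (Function.update (θ a) j (θ a j + t)) (z a).1) (z a).2
        - ℓ (Q.output p (Function.update (θ a) j (θ a j)) (z a).1) (z a).2) := by
    have hu : ∀ t : ℝ, Measurable fun a => Function.update (θ a) j (θ a j + t) := by
      intro t
      refine measurable_pi_iff.2 fun k => ?_
      by_cases hk : k = j
      · subst hk; simpa using hθj.add_const t
      · simpa [hk] using hθ.eval (a := k)
    intro t
    refine ((Q.measurable_loss p hℓm (hu t) hz).sub ?_).const_mul _
    simpa using Q.measurable_loss p hℓm hθ hz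
  refine measurable_of_tendsto_metrizable (fun n : ℕ => hq (1 / ((n : ℝ) + 1)))
    (tendsto_pi_nhds.2 fun a => ?_)
  have hd := (Q.differentiableAt_loss_update hp hℓ (hz𝒴 a) (z a).1 (θ a) j (θ a j)).hasDerivAt
  exact (hasDerivAt_iff_tendsto_slope_zero.1 hd).comp
    (tendsto_nhdsWithin_iff.2 ⟨tendsto_one_div_add_atTop_nhds_zero_nat,
      Filter.Eventually.of_forall fun n => by
        simp only [Set.mem_compl_iff, Set.mem_singleton_iff]; positivity⟩)

theorem measurable_sgd (hp : p ∈ Set.Icc (0 : ℝ) 1)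
    (hℓ : IsLipschitzSmooth ℓ 𝒴 (opNorm Q.obs) C₁ C₂) (hℓm : Measurable (Function.uncurry ℓ))
    (η : ℝ) {m T : ℕ} {X : Type*} [MeasurableSpace X] {θ : X → Fin K → ℝ}
    {S : X → Fin m → (Fin D → ℝ) × ℝ} (hθ : Measurable θ) (hS : Measurable S)
    (hS𝒴 : ∀ a i, (S a i).2 ∈ 𝒴) (ω : Fin T → Fin m) :
    Measurable fun a => Q.sgd p ℓ η (S a) ω (θ a) := by
  unfold sgd
  induction List.ofFn ω generalizing θ with
  | nil => exact hθ
  | cons i is ih =>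
    simp only [List.foldl_cons]
    exact ih (Q.measurable_sgdStep hp hℓ hℓm η hθ ((measurable_pi_apply i).comp hS)
      fun a => hS𝒴 a i)

end DataReuploadingQNN

/-- A quantity that holds almost surely can be arranged to hold surely by a measurable change of
the sample on a null set. -/
theorem exists_measurable_forall_of_ae {Z : Type*} [MeasurableSpace Z] {μ : Measure Z}
    [IsProbabilityMeasure μ] {P : Z → Prop} (h : ∀ᵐ z ∂μ, P z) :
    ∃ π : Z → Z, Measurable π ∧ (∀ z, P (π z)) ∧ ∀ᵐ z ∂μ, π z = z := by
  classical
  obtain ⟨t, hPt, ht, hμt⟩ := exists_measurable_superset_of_null (ae_iff.1 h)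
  have hP : ∀ z, z ∉ t → P z := fun z hz => by
    by_contra hPz
    exact hz (hPt hPz)
  have hae : ∀ᵐ z ∂μ, z ∉ t := by
    rw [ae_iff]
    simpa using hμt
  obtain ⟨z₀, hz₀⟩ := hae.exists
  refine ⟨fun z => if z ∈ t then z₀ else z, Measurable.ite ht measurable_const measurable_id,
    fun z => ?_, hae.mono fun z hz => if_neg hz⟩
  simp only
  split_ifs with hz
  · exact hP _ hz₀
  · exact hP _ hz

/-! ### The expected loss of the learned parameters and the generalization gap. -/

namespace DataReuploadingQNN

variable {N K D L : ℕ} (Q : DataReuploadingQNN N K D L) {p : ℝ} {ℓ : ℝ → ℝ → ℝ} {𝒴 : Set ℝ}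
  {C₁ C₂ M : ℝ}

/-- The expected loss at `z` of the parameters learned from `S`. -/
def sgdLoss (p : ℝ) (ℓ : ℝ → ℝ → ℝ) (η : ℝ) {m : ℕ} (T : ℕ) (ν : Measure (Fin K → ℝ))
    (S : Fin m → (Fin D → ℝ) × ℝ) (z : (Fin D → ℝ) × ℝ) : ℝ :=
  Q.sgdExpectation p ℓ η T ν S fun θ => ℓ (Q.output p θ z.1) z.2

theorem average_mem {m T : ℕ} (hm : 0 < m) {a : (Fin T → Fin m) → ℝ} {M : ℝ}
    (ha : ∀ ω, 0 ≤ a ω ∧ a ω ≤ M) : 0 ≤ (∑ ω, a ω) / (m : ℝ) ^ T ∧ (∑ ω, a ω) / (m : ℝ) ^ T ≤ M := by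
  have hm' : (0 : ℝ) < (m : ℝ) ^ T := pow_pos (by exact_mod_cast hm) T
  refine ⟨div_nonneg (Finset.sum_nonneg fun ω _ => (ha ω).1) hm'.le, ?_⟩
  rw [div_le_iff₀ hm']
  refine (Finset.sum_le_sum fun ω _ => (ha ω).2).trans (le_of_eq ?_)
  simp [mul_comm]

section

variable {η : ℝ} {m T : ℕ} {ν : Measure (Fin K → ℝ)}

theorem loss_mem (hp : p ∈ Set.Icc (0 : ℝ) 1)
    (hM : ∀ y ∈ 𝒴, ∀ a ∈ Set.Icc (-opNorm Q.obs) (opNorm Q.obs), 0 ≤ ℓ a y ∧ ℓ a y ≤ M)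
    {z : (Fin D → ℝ) × ℝ} (hz : z.2 ∈ 𝒴) (θ : Fin K → ℝ) :
    0 ≤ ℓ (Q.output p θ z.1) z.2 ∧ ℓ (Q.output p θ z.1) z.2 ≤ M :=
  hM _ hz _ (Q.output_mem hp θ z.1)

theorem abs_loss_le (hp : p ∈ Set.Icc (0 : ℝ) 1)
    (hM : ∀ y ∈ 𝒴, ∀ a ∈ Set.Icc (-opNorm Q.obs) (opNorm Q.obs), 0 ≤ ℓ a y ∧ ℓ a y ≤ M)
    {z : (Fin D → ℝ) × ℝ} (hz : z.2 ∈ 𝒴) (θ : Fin K → ℝ) : |ℓ (Q.output p θ z.1) z.2| ≤ M := by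
  rw [abs_of_nonneg (Q.loss_mem hp hM hz θ).1]
  exact (Q.loss_mem hp hM hz θ).2

theorem measurable_average_loss (hp : p ∈ Set.Icc (0 : ℝ) 1)
    (hℓ : IsLipschitzSmooth ℓ 𝒴 (opNorm Q.obs) C₁ C₂) (hℓm : Measurable (Function.uncurry ℓ))
    {X : Type*} [MeasurableSpace X] {θ : X → Fin K → ℝ} {S : X → Fin m → (Fin D → ℝ) × ℝ}
    {z : X → (Fin D → ℝ) × ℝ} (hθ : Measurable θ) (hS : Measurable S) (hz : Measurable z)
    (hS𝒴 : ∀ a i, (S a i).2 ∈ 𝒴) :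
    Measurable fun a => (∑ ω : Fin T → Fin m,
      ℓ (Q.output p (Q.sgd p ℓ η (S a) ω (θ a)) (z a).1) (z a).2) / (m : ℝ) ^ T :=
  (Finset.measurable_sum _ fun ω _ => Q.measurable_loss p hℓm
    (Q.measurable_sgd hp hℓ hℓm η hθ hS hS𝒴 ω) hz).div_const _

variable [IsProbabilityMeasure ν]

theorem integrable_average_loss (hp : p ∈ Set.Icc (0 : ℝ) 1)
    (hℓ : IsLipschitzSmooth ℓ 𝒴 (opNorm Q.obs) C₁ C₂) (hℓm : Measurable (Function.uncurry ℓ))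
    (hM : ∀ y ∈ 𝒴, ∀ a ∈ Set.Icc (-opNorm Q.obs) (opNorm Q.obs), 0 ≤ ℓ a y ∧ ℓ a y ≤ M)
    (hm : 0 < m) {S : Fin m → (Fin D → ℝ) × ℝ} {z : (Fin D → ℝ) × ℝ} (hS : ∀ i, (S i).2 ∈ 𝒴)
    (hz : z.2 ∈ 𝒴) :
    Integrable (fun θ₀ => (∑ ω : Fin T → Fin m,
      ℓ (Q.output p (Q.sgd p ℓ η S ω θ₀) z.1) z.2) / (m : ℝ) ^ T) ν := by
  refine integrable_of_measurable_of_abs_le (R := M)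
    (Q.measurable_average_loss hp hℓ hℓm measurable_id measurable_const measurable_const
      fun _ => hS) fun θ₀ => ?_
  have := average_mem hm fun ω : Fin T → Fin m => Q.loss_mem hp hM hz (Q.sgd p ℓ η S ω θ₀)
  rw [abs_of_nonneg this.1]
  exact this.2

theorem sgdLoss_mem (hp : p ∈ Set.Icc (0 : ℝ) 1)
    (hM : ∀ y ∈ 𝒴, ∀ a ∈ Set.Icc (-opNorm Q.obs) (opNorm Q.obs), 0 ≤ ℓ a y ∧ ℓ a y ≤ M)
    (hm : 0 < m) (S : Fin m → (Fin D → ℝ) × ℝ) {z : (Fin D → ℝ) × ℝ} (hz : z.2 ∈ 𝒴) :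
    0 ≤ Q.sgdLoss p ℓ η T ν S z ∧ Q.sgdLoss p ℓ η T ν S z ≤ M := by
  have h : ∀ θ₀, _ := fun θ₀ =>
    average_mem hm fun ω : Fin T → Fin m => Q.loss_mem hp hM hz (Q.sgd p ℓ η S ω θ₀)
  refine ⟨integral_nonneg fun θ₀ => (h θ₀).1, (le_abs_self _).trans ?_⟩
  refine abs_integral_le_of_abs_le fun θ₀ => ?_
  rw [abs_of_nonneg (h θ₀).1]
  exact (h θ₀).2

theorem abs_sgdLoss_update_sub_le (hp : p ∈ Set.Icc (0 : ℝ) 1) (hC₁ : 0 ≤ C₁)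
    (hℓ : IsLipschitzSmooth ℓ 𝒴 (opNorm Q.obs) C₁ C₂) (hℓm : Measurable (Function.uncurry ℓ))
    (hM : ∀ y ∈ 𝒴, ∀ a ∈ Set.Icc (-opNorm Q.obs) (opNorm Q.obs), 0 ≤ ℓ a y ∧ ℓ a y ≤ M)
    (hη : 0 ≤ η) {S : Fin m → (Fin D → ℝ) × ℝ} (hS : ∀ i, (S i).2 ∈ 𝒴) (i : Fin m)
    {w : (Fin D → ℝ) × ℝ} (hw : w.2 ∈ 𝒴) {z : (Fin D → ℝ) × ℝ} (hz : z.2 ∈ 𝒴) :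
    |Q.sgdLoss p ℓ η T ν (Function.update S i w) z - Q.sgdLoss p ℓ η T ν S z|
      ≤ T / m * (C₁ * (Q.damping p * opNorm Q.obs)
          * (K * (2 * (T * (η * (C₁ * (Q.damping p * opNorm Q.obs))))))) := by
  have hS' : ∀ k, (Function.update S i w k).2 ∈ 𝒴 := by
    intro k
    by_cases hk : k = i
    · subst hk; simpa using hw
    · simpa [hk] using hS k
  rw [sgdLoss, sgdLoss, sgdExpectation, sgdExpectation,
    ← integral_sub (Q.integrable_average_loss hp hℓ hℓm hM i.pos hS' hz)
      (Q.integrable_average_loss hp hℓ hℓm hM i.pos hS hz)]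
  exact abs_integral_le_of_abs_le fun θ₀ =>
    Q.abs_average_loss_sgd_update_sub_le hp hC₁ hℓ hη hS i hw θ₀ hz

theorem measurable_sgdLoss (hp : p ∈ Set.Icc (0 : ℝ) 1)
    (hℓ : IsLipschitzSmooth ℓ 𝒴 (opNorm Q.obs) C₁ C₂) (hℓm : Measurable (Function.uncurry ℓ))
    {X : Type*} [MeasurableSpace X] {S : X → Fin m → (Fin D → ℝ) × ℝ}
    {z : X → (Fin D → ℝ) × ℝ} (hS : Measurable S) (hz : Measurable z)
    (hS𝒴 : ∀ a i, (S a i).2 ∈ 𝒴) :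
    Measurable fun a => Q.sgdLoss p ℓ η T ν (S a) (z a) :=
  (StronglyMeasurable.integral_prod_right' (ν := ν)
    (f := fun q : X × (Fin K → ℝ) => (∑ ω : Fin T → Fin m,
      ℓ (Q.output p (Q.sgd p ℓ η (S q.1) ω q.2) (z q.1).1) (z q.1).2) / (m : ℝ) ^ T)
    (Q.measurable_average_loss hp hℓ hℓm measurable_snd (hS.comp measurable_fst)
      (hz.comp measurable_fst) fun q => hS𝒴 q.1).stronglyMeasurable).measurable

/-- The expected generalization gap in terms of the expected loss at a sample. -/
theorem expectedGap_eq (hp : p ∈ Set.Icc (0 : ℝ) 1)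
    (hℓ : IsLipschitzSmooth ℓ 𝒴 (opNorm Q.obs) C₁ C₂) (hℓm : Measurable (Function.uncurry ℓ))
    (hM : ∀ y ∈ 𝒴, ∀ a ∈ Set.Icc (-opNorm Q.obs) (opNorm Q.obs), 0 ≤ ℓ a y ∧ ℓ a y ≤ M)
    (hm : 0 < m) {𝔻 : Measure ((Fin D → ℝ) × ℝ)} [IsProbabilityMeasure 𝔻]
    {π : (Fin D → ℝ) × ℝ → (Fin D → ℝ) × ℝ} (hπ : Measurable π) (hπ𝒴 : ∀ z, (π z).2 ∈ 𝒴)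
    (hπ𝔻 : ∀ᵐ z ∂𝔻, π z = z) {S : Fin m → (Fin D → ℝ) × ℝ} (hS : ∀ i, (S i).2 ∈ 𝒴) :
    Q.expectedGap p ℓ η T ν 𝔻 S
      = ∫ z, Q.sgdLoss p ℓ η T ν S (π z) ∂𝔻 - (∑ i, Q.sgdLoss p ℓ η T ν S (S i)) / m := by
  have hrisk : ∀ θ, Q.risk p ℓ 𝔻 θ = ∫ z, ℓ (Q.output p θ (π z).1) (π z).2 ∂𝔻 := fun θ =>
    integral_congr_ae (hπ𝔻.mono fun z hz => by simp only [hz])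
  have hint : ∀ θ, Integrable (fun z => ℓ (Q.output p θ (π z).1) (π z).2) 𝔻 := fun θ =>
    integrable_of_measurable_of_abs_le (Q.measurable_loss p hℓm measurable_const hπ)
      fun z => Q.abs_loss_le hp hM (hπ𝒴 z) θ
  have hjoint : Measurable fun q : (Fin K → ℝ) × ((Fin D → ℝ) × ℝ) => (∑ ω : Fin T → Fin m,
      ℓ (Q.output p (Q.sgd p ℓ η S ω q.1) (π q.2).1) (π q.2).2) / (m : ℝ) ^ T :=
    Q.measurable_average_loss hp hℓ hℓm measurable_fst measurable_const
      (hπ.comp measurable_snd) fun _ => hS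
  have hjointM : ∀ q : (Fin K → ℝ) × ((Fin D → ℝ) × ℝ), |(∑ ω : Fin T → Fin m,
      ℓ (Q.output p (Q.sgd p ℓ η S ω q.1) (π q.2).1) (π q.2).2) / (m : ℝ) ^ T| ≤ M := by
    intro q
    have := average_mem hm fun ω : Fin T → Fin m => Q.loss_mem hp hM (hπ𝒴 q.2) (Q.sgd p ℓ η S ω q.1)
    rw [abs_of_nonneg this.1]
    exact this.2
  -- Fubini exchanges the test point with the initial parameters; passing through `π` makes the
  -- integrand bounded and measurable everywhere without changing the risk.
  have hmean : ∫ z, Q.sgdLoss p ℓ η T ν S (π z) ∂𝔻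
      = ∫ θ₀, (∑ ω : Fin T → Fin m, Q.risk p ℓ 𝔻 (Q.sgd p ℓ η S ω θ₀)) / (m : ℝ) ^ T ∂ν := by
    simp only [sgdLoss, sgdExpectation]
    rw [← integral_integral_swap (integrable_of_measurable_of_abs_le (f := fun q :
      (Fin K → ℝ) × ((Fin D → ℝ) × ℝ) => (∑ ω : Fin T → Fin m,
        ℓ (Q.output p (Q.sgd p ℓ η S ω q.1) (π q.2).1) (π q.2).2) / (m : ℝ) ^ T) hjoint hjointM)]
    refine integral_congr_ae (Filter.Eventually.of_forall fun θ₀ => ?_)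
    simp only
    rw [integral_div, integral_finsetSum _ fun ω _ => hint _]
    simp only [hrisk]
  have hriskint : Integrable (fun θ₀ =>
      (∑ ω : Fin T → Fin m, Q.risk p ℓ 𝔻 (Q.sgd p ℓ η S ω θ₀)) / (m : ℝ) ^ T) ν := by
    refine (integrable_of_measurable_of_abs_le (μ := ν) (StronglyMeasurable.integral_prod_right'
      (ν := 𝔻) hjoint.stronglyMeasurable).measurable
      fun θ₀ => abs_integral_le_of_abs_le fun z => hjointM (θ₀, z)).congr
      (Filter.Eventually.of_forall fun θ₀ => ?_)
    simp only
    rw [integral_div, integral_finsetSum _ fun ω _ => hint _]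
    simp only [hrisk]
  have hemp : (∑ i, Q.sgdLoss p ℓ η T ν S (S i)) / m = ∫ θ₀, (∑ i, (∑ ω : Fin T → Fin m,
      ℓ (Q.output p (Q.sgd p ℓ η S ω θ₀) (S i).1) (S i).2) / (m : ℝ) ^ T) / m ∂ν := by
    rw [integral_div, integral_finsetSum _ fun i _ =>
      Q.integrable_average_loss hp hℓ hℓm hM hm hS (hS i)]
    rfl
  rw [hmean, hemp, ← integral_sub hriskint ((integrable_finsetSum _ fun i _ =>
    Q.integrable_average_loss hp hℓ hℓm hM hm hS (hS i)).div_const _), expectedGap,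
    sgdExpectation]
  refine integral_congr_ae (Filter.Eventually.of_forall fun θ₀ => ?_)
  simp only [empiricalRisk]
  rw [Finset.sum_sub_distrib, sub_div, ← Finset.sum_div, ← Finset.sum_div, Finset.sum_comm,
    div_right_comm]

end

end DataReuploadingQNN

/-- The growth function of the bound. -/
def growth (C₁ : ℝ) (T : ℕ) (b : ℝ) : ℝ := 4 * C₁ ^ 2 * T ^ 2 * b

theorem isBigOPow_growth (C₁ : ℝ) : IsBigOPow (growth C₁) := by
  refine ⟨fun T a _ b _ hab => mul_le_mul_of_nonneg_left hab (by positivity),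
    (4 * C₁ ^ 2 + 1) * 4, by positivity, fun T b hb => ?_⟩
  have hb0 : 0 ≤ b := by linarith
  rw [growth, abs_of_nonneg (by positivity)]
  -- For `T = 0` the growth function is zero. Otherwise `T ^ 2 ≤ 4 ^ T` accounts for the factor `4`
  -- of the constant, and the remaining factors are absorbed by `a ≤ a ^ T` for `a ≥ 1`.
  rcases T.eq_zero_or_pos with rfl | hT
  · simp
  · have hT2 : (T : ℝ) ^ 2 ≤ 4 ^ T := by
      have : (T : ℝ) ≤ 2 ^ T := by exact_mod_cast Nat.lt_two_pow_self.le
      calc (T : ℝ) ^ 2 ≤ (2 ^ T) ^ 2 := by gcongr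
        _ = 4 ^ T := by rw [← pow_mul, mul_comm, pow_mul]; norm_num
    have hC : 4 * C₁ ^ 2 ≤ (4 * C₁ ^ 2 + 1) ^ T :=
      (by linarith : 4 * C₁ ^ 2 ≤ 4 * C₁ ^ 2 + 1).trans
        (le_self_pow₀ (by linarith [sq_nonneg C₁]) hT.ne')
    rw [mul_pow, mul_pow]
    gcongr
    exact le_self_pow₀ hb hT.ne'

/-- The damping enters squared: once through the size of the steps, once through the sensitivity of
the loss. One factor is dropped, the other is split as `r * q`, and `n ≥ 1` is inserted. -/
theorem stability_le_growth {q r B d η C₁ : ℝ} (K T n : ℕ) {m : ℕ} (hm : 0 < m)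
    (hq : 0 ≤ q ∧ q ≤ 1) (hr : 0 ≤ r ∧ r ≤ 1) (hB : 0 ≤ B) (hd : 0 ≤ d) (hdr : d ≤ r * q)
    (hη : 0 ≤ η) (hn : 1 ≤ n) :
    2 * m * (T / m * (C₁ * (d * B) * (K * (2 * (T * (η * (C₁ * (d * B))))))))
      ≤ r * n * B * growth C₁ T (η * q * K * B) := by
  have hm' : (m : ℝ) ≠ 0 := by exact_mod_cast hm.ne'
  have hn' : (1 : ℝ) ≤ n := by exact_mod_cast hn
  have hdd : d * d ≤ r * n * q := by
    have hd1 : d ≤ 1 := hdr.trans (mul_le_one₀ hr.2 hq.1 hq.2)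
    calc d * d ≤ r * q := (mul_le_of_le_one_right hd hd1).trans hdr
      _ ≤ r * n * q := mul_le_mul_of_nonneg_right (le_mul_of_one_le_right hr.1 hn') hq.1
  calc _ = d * d * (4 * C₁ ^ 2 * T ^ 2 * (η * K * (B * B))) := by field_simp; ring
    _ ≤ r * n * q * (4 * C₁ ^ 2 * T ^ 2 * (η * K * (B * B))) := by gcongr
    _ = _ := by rw [growth]; ring

end NoisyQNN
end

/-! ### The generalization bound. -/

theorem mainTheorem6 (C₁ C₂ : ℝ) (hC₁ : 0 ≤ C₁) (hC₂ : 0 ≤ C₂) :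
    ∃ g : ℕ → ℝ → ℝ, NoisyQNN.IsBigOPow g ∧
      ∀ (N K D L m T : ℕ) (_hD : 1 ≤ D) (_hL : 1 ≤ L) (_hm : 1 ≤ m)
        (Q : NoisyQNN.DataReuploadingQNN N K D L)
        (p : ℝ) (_hp : p ∈ Set.Icc (0 : ℝ) 1) (η : ℝ) (_hη : 0 < η)
        (𝒴 : Set ℝ) (ℓ : ℝ → ℝ → ℝ) (_hℓ : Measurable (Function.uncurry ℓ))
        (_hℓs : NoisyQNN.IsLipschitzSmooth ℓ 𝒴 (NoisyQNN.opNorm Q.obs) C₁ C₂)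
        (M : ℝ)
        (_hM : ∀ y ∈ 𝒴, ∀ a ∈ Set.Icc (-NoisyQNN.opNorm Q.obs) (NoisyQNN.opNorm Q.obs),
          0 ≤ ℓ a y ∧ ℓ a y ≤ M)
        (𝔻 : MeasureTheory.Measure ((Fin D → ℝ) × ℝ)) (_h𝔻 : MeasureTheory.IsProbabilityMeasure 𝔻)
        (_h𝒴 : ∀ᵐ z ∂𝔻, z.2 ∈ 𝒴)
        (ν : MeasureTheory.Measure (Fin K → ℝ)) (_hν : MeasureTheory.IsProbabilityMeasure ν)
        (δ : ℝ) (_hδ : δ ∈ Set.Ioo (0 : ℝ) 1),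
        ENNReal.ofReal (1 - δ) ≤
          MeasureTheory.Measure.pi (fun _ : Fin m => 𝔻)
            {S | Q.expectedGap p ℓ η T ν 𝔻 S ≤
              (1 - p) ^ (L * D) * (L * D) * NoisyQNN.opNorm Q.obs / m
                  * g T (η * (1 - p) ^ K * K * NoisyQNN.opNorm Q.obs)
                + ((1 - p) ^ (L * D) * (L * D) * NoisyQNN.opNorm Q.obs
                    * g T (η * (1 - p) ^ K * K * NoisyQNN.opNorm Q.obs) + M)
                  * Real.sqrt (Real.log (1 / δ) / (2 * m))} := by
  refine ⟨NoisyQNN.growth C₁, NoisyQNN.isBigOPow_growth C₁, ?_⟩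
  intro N K D L m T hD hL hm Q p hp η hη 𝒴 ℓ hℓm hℓ M hM 𝔻 h𝔻 h𝒴 ν hν δ hδ
  obtain ⟨π, hπ, hπ𝒴, hπ𝔻⟩ := NoisyQNN.exists_measurable_forall_of_ae h𝒴
  have hm' : (0 : ℝ) < m := by exact_mod_cast hm
  have hp0 : 0 ≤ 1 - p := by linarith [hp.2]
  have hp1 : 1 - p ≤ 1 := by linarith [hp.1]
  have hB := NoisyQNN.opNorm_nonneg Q.obs
  have hd := Q.damping_mem hp
  set B := NoisyQNN.opNorm Q.obs with hBdef
  set β : ℝ := T / m * (C₁ * (Q.damping p * B) * (K * (2 * (T * (η * (C₁ * (Q.damping p * B)))))))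
    with hβ
  set G := (1 - p) ^ (L * D) * (L * D) * B
    * NoisyQNN.growth C₁ T (η * (1 - p) ^ K * K * B) with hG
  have hβ0 : 0 ≤ β := by
    have := hd.1
    positivity
  have hβG : 2 * m * β ≤ G := by
    have := NoisyQNN.stability_le_growth (C₁ := C₁) K T (L * D) hm
      ⟨pow_nonneg hp0 K, pow_le_one₀ hp0 hp1⟩ ⟨pow_nonneg hp0 (L * D), pow_le_one₀ hp0 hp1⟩ hB
      hd.1 (Q.damping_le hp) hη.le (Nat.mul_pos hL hD)
    push_cast at this
    exact this
  -- All samples pass through `π`, so that measurability, boundedness and stability hold for every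
  -- sample and not just almost surely.
  have hH : Measurable (Function.uncurry fun (S : Fin m → (Fin D → ℝ) × ℝ) z =>
      Q.sgdLoss p ℓ η T ν (fun i => π (S i)) (π z)) :=
    Q.measurable_sgdLoss (X := (Fin m → (Fin D → ℝ) × ℝ) × ((Fin D → ℝ) × ℝ))
      (S := fun a i => π (a.1 i)) (z := fun a => π a.2) hp hℓ hℓm
      (measurable_pi_iff.2 fun i => hπ.comp ((measurable_pi_apply i).comp measurable_fst))
      (hπ.comp measurable_snd) fun a i => hπ𝒴 (a.1 i)
  have hHM : ∀ (S : Fin m → (Fin D → ℝ) × ℝ) z,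
      0 ≤ Q.sgdLoss p ℓ η T ν (fun i => π (S i)) (π z)
        ∧ Q.sgdLoss p ℓ η T ν (fun i => π (S i)) (π z) ≤ M :=
    fun S z => Q.sgdLoss_mem hp hM hm _ (hπ𝒴 z)
  have hHβ : ∀ (S : Fin m → (Fin D → ℝ) × ℝ) i w z,
      |Q.sgdLoss p ℓ η T ν (fun k => π (Function.update S i w k)) (π z)
        - Q.sgdLoss p ℓ η T ν (fun k => π (S k)) (π z)| ≤ β := by
    intro S i w z
    have hup : (fun k => π (Function.update S i w k))
        = Function.update (fun k => π (S k)) i (π w) :=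
      funext fun k => Function.apply_update (fun _ => π) S i w k
    rw [hup]
    exact Q.abs_sgdLoss_update_sub_le hp hC₁ hℓ hℓm hM hη.le (fun k => hπ𝒴 _) i (hπ𝒴 w) (hπ𝒴 z)
  have hstab := measure_gap_le_of_uniformly_stable 𝔻 hβ0 hm hH hHM hHβ hδ
  refine hstab.trans (MeasureTheory.measure_mono_ae ?_)
  -- Almost every training set is fixed by `π`, so the bound for the modified rule transfers to the
  -- actual gap up to a null set.
  have hall : ∀ᵐ S ∂(MeasureTheory.Measure.pi fun _ : Fin m => 𝔻), ∀ i, π (S i) = S i :=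
    Filter.eventually_all.2 fun i =>
      (MeasureTheory.Measure.tendsto_eval_ae_ae (μ := fun _ : Fin m => 𝔻) (i := i)).eventually hπ𝔻
  filter_upwards [hall] with S hS hgap
  have hS' : (fun i => π (S i)) = S := funext hS
  have hS𝒴 : ∀ i, (S i).2 ∈ 𝒴 := fun i => hS i ▸ hπ𝒴 (S i)
  have hgap' : Q.expectedGap p ℓ η T ν 𝔻 S
      ≤ β + (2 * m * β + M) * Real.sqrt (Real.log (1 / δ) / (2 * m)) := by
    rw [Q.expectedGap_eq hp hℓ hℓm hM hm hπ hπ𝒴 hπ𝔻 hS𝒴]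
    have h : ∫ z, Q.sgdLoss p ℓ η T ν (fun i => π (S i)) (π z) ∂𝔻
        - (∑ i, Q.sgdLoss p ℓ η T ν (fun i => π (S i)) (π (S i))) / m
        ≤ β + (2 * m * β + M) * Real.sqrt (Real.log (1 / δ) / (2 * m)) := hgap
    simpa only [hS', hS] using h
  -- The first term needs only `m * β ≤ G`; the factor `2` in `hβG` is required by the deviation
  -- term.
  have hβm : β ≤ G / m := by
    rw [le_div_iff₀ hm']
    nlinarith [mul_nonneg hβ0 hm'.le]
  refine hgap'.trans (add_le_add (hβm.trans (le_of_eq ?_)) ?_)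
  · rw [hG]; ring
  · exact mul_le_mul_of_nonneg_right (by linarith) (Real.sqrt_nonneg _)
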